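/- **Setting.** Time is $\mathbb R_{\ge 0}$. A (constrained-deadline, mixed-criticality, sporadic) task $\tau_i=(T_i,L_i,\{C_i^L,C_i^H\},D_i)$ with tightened deadline $D_i^L$ has minimum separation $T_i$, level $L_i\in\{LC,HC\}$, $0<C_i^L\le D_i^L\le D_i\le T_i$, $C_i^L<C_i^H$ if $L_i=HC$, and $C_i^L=C_i^H$, $D_i^L=D_i$ if $L_i=LC$. A component $\mathbb C$ is a finite set of tasks with a tolerance limit $TL\in\mathbb N$, scheduled by preemptive EDF on one processor. An HC task switches to HC mode when one of its jobs has executed for $C_i^L$ and needs more; its jobs have relative deadline $D_i^L$ before the switch and $D_i$ afterwards. The internal mode switch (IMS) of $\mathbb C$ is the first switch of one of its HC tasks, the external mode switch (EMS) is the switch of the $(TL+1)$-st HC task. LC tasks of $\mathbb C$ are dropped at the IMS of $\mathbb C$ or at the first EMS of another component, whichever is earlier. An interface $\mathbb I=(T,L,\{C^L,C^H\})$, with $0\le C^L\le C^H\le T$ and $T>0$, guarantees at least $C^L$ units of processor time in each of the consecutive periods of length $T$ (of any phase, at arbitrary times within the period). $\mathbb C$ is *schedulable in LC mode* with $\mathbb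 I$ if, for all sporadic releases, all execution times of at most $C_i^H$, all admissible supplies and all resolutions of ties, every deadline in force of a task that is not dropped is met as long as no EMS of $\mathbb C$ has occurred. **Demand.** For a job released at $r$ put $$A_i(r,t,s)=\begin{cases}C_i^L & r+D_i^L<s\\ C_i^H & r+D_i^L\ge s,\ r+D_i\le t\\ \min\{s-r,C_i^L\} & s\le r+D_i^L\le t<r+D_i\\ 0& r+D_i^L>t\end{cases}$$ and $B_i(r,t,s)=\min\{s-r,C_i^L\}$ if $r+D_i^L\le t$, and $0$ otherwise. With $k=\lfloor s/T_i\rfloor$, $q=\lfloor (t-D_i)/T_i\rfloor$, $r_0=t-D_i-qT_i$, $b=\lfloor (s-r_0)/T_i\rfloor$, $a=q-b$ let $\mathrm{dbf}_a=kC_i^L+B_i(kT_i,t,s)$, $\mathrm{dbf}_b=kC_i^L+A_i(kT_i,t,s)$, and $\mathrm{dbf}_c=bC_i^L+A_i(r_0+bT_i,t,s)+aC_i^H$, except that $\mathrm{dbf}_c=0$ if $t<D_i$, and $\mathrm{dbf}_c=aC_i^H$ if $t\ge D_i$ and $s<r_0$. Then $\mathrm{dbf}(\tau_i,t,s)$ is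 $\mathrm{dbf}_a$ if $L_i=LC$; and for $L_i=HC$ it is $\mathrm{dbf}_b$ if $t-s<D_i-D_i^L$, $\mathrm{dbf}_c$ if $t-s\ge D_i$, and $\max\{\mathrm{dbf}_b,\mathrm{dbf}_c\}$ otherwise. With $\Delta_i=\max\{0,\mathrm{dbf}(\tau_i,t,t_I)-\mathrm{dbf}(\tau_i,t,t_E)\}$, $$\mathrm{dbf}(\mathbb C,t,t_E,t_I)=\sum_{L_i=HC}\mathrm{dbf}(\tau_i,t,t_E)+\sum_{\tau_i\in\mathcal G}\Delta_i+\sum_{L_i=LC}\mathrm{dbf}(\tau_i,t,t_I),$$ where $\mathcal G$ consists of the $TL$ HC tasks with the largest $\Delta_i$ (all of them if there are fewer than $TL$). **Supply.** With $n=\max\{0,\lfloor (t-(T-C^L))/T\rfloor\}$, $$\mathrm{sbf}_{\mathbb I}(t,t)=nC^L+\max\{0,\,t-2(T-C^L)-nT\}.$$ **Test range.** Let $\rho=\sum_{L_i=HC}\frac{C_i^L}{T_i}+\max\Big\{\sum_{L_i=LC}\frac{C_i^L}{T_i},\ V\Big\}$, where $V$ is the sum of the $TL$ largest values of $(C_i^H-C_i^L)/T_i$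 over the HC tasks (of all of them if there are fewer than $TL$), and $\sigma=C^L/T-\rho$. If $\sigma>0$ let $$t_{MAX}=\frac1\sigma\Big(\sum_{L_i=HC}(2T_i-D_i)\frac{C_i^H}{T_i}+\sum_{L_i=LC}C_i^L+2\frac{C^L}{T}(T-C^L)\Big),$$ and let $t_{MAX}=\infty$ if $\sigma\le 0$. **Theorem 2.** If $$\mathrm{dbf}(\mathbb C,t,t,t_I)\le \mathrm{sbf}_{\mathbb I}(t,t)\qquad\text{for all } t \text{ with } 0\le t\le t_{MAX} \text{ (all } t\ge 0\text{ if } t_{MAX}=\infty)\text{ and all } 0\le t_I\le t,$$ then $\mathbb C$ is schedulable in LC mode with $\mathbb I$. Moreover, $t_{MAX}$ is pseudo-polynomial: if $\sigma>0$, the component has $N$ tasks, and $M$ is an upper bound of $T$ and of all $T_i$ and $C_i^H$, then $t_{MAX}\le 2(N+1)M/\sigma$. -/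

import Mathlib

open MeasureTheory

noncomputable section

namespace MixedCrit

/-! ### Tasks, components and interfaces -/

/-- The two criticality levels. -/
inductive Level where
  | LC
  | HC
  deriving DecidableEq

/-- A constrained-deadline mixed-criticality sporadic task: minimum separation `T`, criticality
level, LC and HC worst-case execution times `CL`, `CH`, relative deadline `D`, and the tightened
relative deadline `DL` that is used for its jobs while the task is in LC mode. -/
structure MCTask where
  T : ℝ
  level : Level
  CL : ℝ
  CH : ℝ
  D : ℝ
  DL : ℝ
  CL_pos : 0 < CL
  CL_le_DL : CL ≤ DL
  DL_le_D : DL ≤ D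
  D_le_T : D ≤ T
  CH_of_LC : level = Level.LC → CL = CH
  CH_of_HC : level = Level.HC → CL < CH
  DL_of_LC : level = Level.LC → DL = D

/-- A component: a finite workload of tasks and an HC tolerance limit. Its local scheduler is EDF
(see `Run`). -/
structure Component (ι : Type*) where
  task : ι → MCTask
  TL : ℕ

/-- A mixed-criticality periodic resource: period, level, LC and HC capacity. -/
structure MCPR where
  T : ℝ
  level : Level
  CL : ℝ
  CH : ℝ
  T_pos : 0 < T
  CL_nonneg : 0 ≤ CL
  CL_le_CH : CL ≤ CH
  CH_le_T : CH ≤ T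

/-! ### Demand bound functions -/

namespace MCTask

/-- Demand in `[0, t)` of the last job that an HC task releases (at time `r`) before it switches to
HC mode at `ti`. -/
def dbfJobA (τ : MCTask) (r t ti : ℝ) : ℝ :=
  if r + τ.DL < ti then τ.CL
  else if r + τ.D ≤ t then τ.CH
  else if r + τ.DL ≤ t then min (ti - r) τ.CL
  else 0

/-- Demand in `[0, t)` of the last job that an LC task releases (at time `r`) before it is dropped
at `ti`. -/
def dbfJobB (τ : MCTask) (r t ti : ℝ) : ℝ :=
  if r + τ.DL ≤ t then min (ti - r) τ.CL else 0

/-- Condition a: LC task, jobs released at `0, T, 2T, …`. -/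
def dbfA (τ : MCTask) (t ti : ℝ) : ℝ :=
  ⌊ti / τ.T⌋ * τ.CL + τ.dbfJobB (⌊ti / τ.T⌋ * τ.T) t ti

/-- Condition b: HC task, jobs released at `0, T, 2T, …`. -/
def dbfB (τ : MCTask) (t ti : ℝ) : ℝ :=
  ⌊ti / τ.T⌋ * τ.CL + τ.dbfJobA (⌊ti / τ.T⌋ * τ.T) t ti

/-- First release of the periodic pattern in which some job has its deadline exactly at `t`. -/
def firstRelease (τ : MCTask) (t : ℝ) : ℝ :=
  t - τ.D - ⌊(t - τ.D) / τ.T⌋ * τ.T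

/-- The number `b` of jobs of that pattern that precede the last job released by time `ti`. It is
`-1` if `ti` lies before the first release of the pattern. -/
def numB (τ : MCTask) (t ti : ℝ) : ℤ :=
  ⌊(ti - τ.firstRelease t) / τ.T⌋

/-- The number `a` of jobs of that pattern that are released after `ti` and have their deadline
at or before `t`. -/
def numA (τ : MCTask) (t ti : ℝ) : ℤ :=
  ⌊(t - τ.D) / τ.T⌋ - τ.numB t ti

/-- Condition c: HC task, releases such that some deadline is at `t`. If `t < D`, this pattern has
no job in the interval, and if `ti` precedes its first release, there is no job released before the
mode switch, so only the jobs released after the switch count. -/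
def dbfC (τ : MCTask) (t ti : ℝ) : ℝ :=
  if t < τ.D then 0
  else if ti < τ.firstRelease t then τ.numA t ti * τ.CH
  else τ.numB t ti * τ.CL + τ.dbfJobA (τ.firstRelease t + τ.numB t ti * τ.T) t ti
    + τ.numA t ti * τ.CH

/-- The demand bound function of a task for an interval of length `t`. The task switches to HC mode
(if it is an HC task) or is dropped (if it is an LC task) at `ti`. -/
def dbf (τ : MCTask) (t ti : ℝ) : ℝ :=
  if τ.level = Level.LC then τ.dbfA t ti
  else if t - ti < τ.D - τ.DL then τ.dbfB t ti
  else if τ.D ≤ t - ti then τ.dbfC t ti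
  else max (τ.dbfB t ti) (τ.dbfC t ti)

end MCTask

/-- The largest sum of at most `k` values of `f` on `s`: for nonnegative `f`, the sum of the `k`
largest values (of all values, if there are fewer than `k`). -/
def topSum {ι : Type*} (s : Finset ι) (k : ℕ) (f : ι → ℝ) : ℝ :=
  (s.powerset.filter (fun G => G.card ≤ k)).sup' ⟨∅, by simp⟩ (fun G => ∑ i ∈ G, f i)

namespace Component

variable {ι : Type*} [Fintype ι]

/-- The LC tasks of the component. -/
def lcTasks (C : Component ι) : Finset ι :=
  Finset.univ.filter (fun i => (C.task i).level = Level.LC)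

/-- The HC tasks of the component. -/
def hcTasks (C : Component ι) : Finset ι :=
  Finset.univ.filter (fun i => (C.task i).level = Level.HC)

/-- Increase of the demand of task `i` if it switches at `tI` instead of `tE`. -/
def delta (C : Component ι) (t tE tI : ℝ) (i : ι) : ℝ :=
  max 0 ((C.task i).dbf t tI - (C.task i).dbf t tE)

/-- The demand bound function of a component for an interval of length `t`, with external mode
switch at `tE` and internal mode switch at `tI`. -/
def dbf (C : Component ι) (t tE tI : ℝ) : ℝ :=
  ∑ i ∈ C.hcTasks, (C.task i).dbf t tE + topSum C.hcTasks C.TL (C.delta t tE tI)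
    + ∑ i ∈ C.lcTasks, (C.task i).dbf t tI

end Component

/-! ### Supply bound function without external mode switch -/

/-- The supply bound function of the interface for an interval of length `t` without external mode
switch (`tE = t`). -/
def MCPR.sbfLC (I : MCPR) (t : ℝ) : ℝ :=
  let n : ℝ := max 0 (⌊(t - (I.T - I.CL)) / I.T⌋ : ℝ)
  n * I.CL + max 0 (t - 2 * (I.T - I.CL) - n * I.T)

/-! ### The length of the longest interval that has to be tested -/

section tMax

variable {ι : Type*} [Fintype ι]

/-- The largest long-run demand rate of the component before its external mode switch: either no
task has switched (all tasks at their LC utilizations), or the LC tasks are dropped and the at most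
`TL` worst HC tasks run at their HC utilizations. -/
def Component.rate (C : Component ι) : ℝ :=
  ∑ i ∈ C.hcTasks, (C.task i).CL / (C.task i).T +
    max (∑ i ∈ C.lcTasks, (C.task i).CL / (C.task i).T)
      (topSum C.hcTasks C.TL (fun i => ((C.task i).CH - (C.task i).CL) / (C.task i).T))

/-- Bandwidth of the interface in LC mode minus the demand rate of the component. -/
def slack (C : Component ι) (I : MCPR) : ℝ :=
  I.CL / I.T - C.rate

/-- The bound `t_MAX` on the interval lengths to be tested; there is no bound (`⊤`) unless the
bandwidth of the interface exceeds the demand rate of the component. -/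
def tMAX (C : Component ι) (I : MCPR) : EReal :=
  if 0 < slack C I then
    (((∑ i ∈ C.hcTasks, (2 * (C.task i).T - (C.task i).D) * ((C.task i).CH / (C.task i).T)
        + ∑ i ∈ C.lcTasks, (C.task i).CL
        + 2 * (I.CL / I.T) * (I.T - I.CL)) / slack C I : ℝ) : EReal)
  else ⊤

end tMax

/-! ### Execution semantics -/

/-- The data of an execution of a component, from time `0` on. A job is identified with its task
`i` and its release time `r ∈ release i`. -/
structure Trace (ι : Type*) where
  /-- release times of each task -/
  release : ι → Set ℝ
  /-- the execution requirement of each job -/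
  cost : ι → ℝ → ℝ
  /-- the times at which the interface supplies the processor to the component -/
  supply : Set ℝ
  /-- the times at which each job executes -/
  run : ι → ℝ → Set ℝ
  /-- the earliest external mode switch of another component of the system (`⊤` if none) -/
  otherEMS : EReal

namespace Trace

variable {ι : Type*} (X : Trace ι) (C : Component ι)

/-- The amount of execution that job `(i, r)` has received by time `t`. -/
def exec (i : ι) (r t : ℝ) : ℝ :=
  volume.real (X.run i r ∩ Set.Icc r t)

/-- Task `i` is in HC mode at time `t`: by then one of its jobs has used up the LC execution time
and requires more. -/
def InHC (i : ι) (t : ℝ) : Prop :=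
  (C.task i).level = Level.HC ∧
    ∃ r ∈ X.release i, r ≤ t ∧ (C.task i).CL < X.cost i r ∧ (C.task i).CL ≤ X.exec i r t

/-- The internal mode of the component is HC at time `t`. -/
def IMS (t : ℝ) : Prop :=
  ∃ i, X.InHC C i t

/-- The external mode of the component is HC at time `t`: more than `TL` HC tasks have switched. -/
def EMS (t : ℝ) : Prop :=
  C.TL < {i | X.InHC C i t}.ncard

/-- Task `i` has been dropped by time `t`: it is an LC task, and the component had its internal
mode switch or another component its external mode switch. -/
def Dropped (i : ι) (t : ℝ) : Prop :=
  (C.task i).level = Level.LC ∧ (X.IMS C t ∨ X.otherEMS ≤ (t : EReal))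

open Classical in
/-- The absolute deadline of job `(i, r)` in force at time `t`: tightened while its task is in LC
mode, the actual one afterwards. -/
def deadline (i : ι) (r t : ℝ) : ℝ :=
  if X.InHC C i t then r + (C.task i).D else r + (C.task i).DL

/-- Job `(i, r)` is pending at time `t`. -/
def Pending (i : ι) (r t : ℝ) : Prop :=
  r ∈ X.release i ∧ r ≤ t ∧ X.exec i r t < X.cost i r ∧ ¬ X.Dropped C i t

/-- The trace is an execution of the component under EDF, on the resource supplied by the
interface, as long as the external mode of the component is LC. -/
structure IsRun (I : MCPR) : Prop where
  release_nonneg : ∀ i, ∀ r ∈ X.release i, 0 ≤ r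
  /-- sporadic releases -/
  separation : ∀ i, ∀ r ∈ X.release i, ∀ r' ∈ X.release i, r < r' → r + (C.task i).T ≤ r'
  cost_nonneg : ∀ i, ∀ r ∈ X.release i, 0 ≤ X.cost i r
  /-- the HC execution time of an LC task is the LC one -/
  cost_le : ∀ i, ∀ r ∈ X.release i, X.cost i r ≤ (C.task i).CH
  measurable_supply : MeasurableSet X.supply
  /-- at least `CL` units of the resource, at arbitrary times, in each of the consecutive
  interface periods, which may have any phase -/
  supply_periodic : ∃ φ : ℝ, ∀ k : ℤ, ENNReal.ofReal I.CL ≤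
    volume (X.supply ∩ Set.Ico (φ + k * I.T) (φ + (k + 1) * I.T))
  measurable_run : ∀ i r, MeasurableSet (X.run i r)
  /-- a single processor -/
  one_job : ∀ i r j r' t, t ∈ X.run i r → t ∈ X.run j r' → i = j ∧ r = r'
  /-- only a pending job executes, only on supplied time, and only if no other pending job has an
  earlier deadline -/
  edf : ∀ᵐ t : ℝ, ¬ X.EMS C t → ∀ i r, t ∈ X.run i r →
    t ∈ X.supply ∧ X.Pending C i r t ∧
      ∀ j r', X.Pending C j r' t → X.deadline C i r t ≤ X.deadline C j r' t
  /-- supplied time is not left unused while a job is pending -/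
  work_conserving : ∀ᵐ t : ℝ, ¬ X.EMS C t → t ∈ X.supply →
    (∃ i r, X.Pending C i r t) → ∃ i r, t ∈ X.run i r

/-- Every job of a task that has not been dropped and whose deadline in force at `t` is `t` is
complete at time `t`. -/
def MeetsDeadlinesAt (t : ℝ) : Prop :=
  ∀ i, ∀ r ∈ X.release i, ¬ X.Dropped C i t → X.deadline C i r t = t →
    X.cost i r ≤ X.exec i r t

end Trace

/-- The component is schedulable in LC mode with the interface: in every execution, all deadlines
are met as long as the external mode of the component is LC. -/
def SchedulableInLCMode {ι : Type*} (C : Component ι) (I : MCPR) : Prop :=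
  ∀ X : Trace ι, X.IsRun C I → ∀ t : ℝ, ¬ X.EMS C t → X.MeetsDeadlinesAt C t

end MixedCrit

end

/-!
A first deadline miss, at time `t`, is confronted with the supply of the busy period before it.

Call a pending job urgent if its deadline in force is at most `t`. Deadlines in force only increase,
so there is a busy period `(a, t)` in which some job is always urgent, and every job that is urgent
in it is released at or after `a` (`Trace.IsRun.exists_busy_start`). By EDF all supply in `(a, t)`
goes to urgent jobs (`Trace.IsRun.supply_le`), and this supply is at least `sbfLC (t - a)`
(`sbfLC_le_supply`). As the missing job is unfinished, the demand of the urgent jobs exceeds their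
execution by some `g > 0` (`Trace.IsRun.exists_isDemand`). It remains to bound the demand by
`dbf (t - a) (t - a) (u - a)` for a suitable switching time `u`.

The time `u` is chosen less than `g / 2` before the first internal mode switch, but not before `a`
(and `u = t` if there is no switch by `t`). After the switch LC tasks do not execute, so that
ignoring their execution after `u` costs at most `g / 2`. Stepping back from the switch also avoids
the boundary case in which a job switches its task exactly at its tightened deadline, where `dbf` at
the switching time itself counts the job only at its LC execution time if `DL = D = T`.

Since there is no earlier miss, a job that exceeds `CL` has its tightened deadline after `u`, its
actual deadline by `t`, and its task is in HC mode when its next job is released. Hence the jobs of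
an HC task are bounded by `c * CL + (h + 1) * CH`, where the pattern fits between `a` and `t`, and
such a sum is at most `dbf (t - a) (u - a)` (`MCTask.mul_CL_add_mul_CH_le_dbf`). A task without such
a job is bounded by `dbf (t - a) (t - a)`. The tasks of the first kind have switched by `t`, so
there are at most `TL` of them, and their surplus is part of the sum of the `TL` largest increases.

Interval lengths beyond `tMAX` need no test: `dbf` lies below a line of slope `rate`
(`Component.dbf_le_rate`), `sbfLC` above one of slope `CL / T` (`le_sbfLC`), and these lines meet
at `tMAX`.
-/

namespace MixedCrit

/-! ### Demand bound functions of a task -/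

namespace MCTask

lemma T_pos (τ : MCTask) : 0 < τ.T := by
  linarith [τ.CL_pos, τ.CL_le_DL, τ.DL_le_D, τ.D_le_T]

lemma DL_pos (τ : MCTask) : 0 < τ.DL := by
  linarith [τ.CL_pos, τ.CL_le_DL]

lemma D_pos (τ : MCTask) : 0 < τ.D := by
  linarith [τ.DL_pos, τ.DL_le_D]

lemma CL_le_CH (τ : MCTask) : τ.CL ≤ τ.CH := by
  cases h : τ.level with
  | LC => exact (τ.CH_of_LC h).le
  | HC => exact (τ.CH_of_HC h).le

lemma CH_pos (τ : MCTask) : 0 < τ.CH := τ.CL_pos.trans_le τ.CL_le_CH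

lemma floor_mul_le (τ : MCTask) (x : ℝ) : (⌊x / τ.T⌋ : ℝ) * τ.T ≤ x := by
  have := Int.floor_le (x / τ.T)
  rwa [le_div_iff₀ τ.T_pos] at this

lemma lt_floor_mul (τ : MCTask) (x : ℝ) : x < ((⌊x / τ.T⌋ : ℝ) + 1) * τ.T := by
  have := Int.lt_floor_add_one (x / τ.T)
  rwa [div_lt_iff₀ τ.T_pos] at this

lemma floor_nonneg (τ : MCTask) {x : ℝ} (hx : 0 ≤ x) : (0 : ℝ) ≤ (⌊x / τ.T⌋ : ℝ) := by
  exact_mod_cast Int.floor_nonneg.2 (div_nonneg hx τ.T_pos.le)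

lemma dbfJobA_nonneg (τ : MCTask) {r t ti : ℝ} (h : r ≤ ti) : 0 ≤ τ.dbfJobA r t ti := by
  unfold dbfJobA
  have := τ.CL_pos
  have := τ.CH_pos
  split_ifs
  · linarith
  · linarith
  · exact le_min (by linarith) (by linarith)
  · exact le_rfl

lemma dbfJobB_nonneg (τ : MCTask) {r t ti : ℝ} (h : r ≤ ti) : 0 ≤ τ.dbfJobB r t ti := by
  unfold dbfJobB
  split_ifs
  · exact le_min (by linarith) τ.CL_pos.le
  · exact le_rfl

lemma dbfJobA_le_CH (τ : MCTask) (r t ti : ℝ) : τ.dbfJobA r t ti ≤ τ.CH := by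
  unfold dbfJobA
  have := τ.CL_le_CH
  have := τ.CH_pos
  split_ifs
  · linarith
  · linarith
  · exact (min_le_right _ _).trans (by linarith)
  · linarith

/-- The pattern with releases at `0, T, 2T, …` enters the demand bound unless `D ≤ t - ti`. -/
lemma dbfB_le_dbf (τ : MCTask) (hτ : τ.level = Level.HC) {t ti : ℝ} (h : t - ti < τ.D) :
    τ.dbfB t ti ≤ τ.dbf t ti := by
  have h1 : ¬ τ.level = Level.LC := by simp [hτ]
  unfold dbf
  rw [if_neg h1]
  split_ifs
  · exact le_rfl
  · linarith
  · exact le_max_left _ _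

/-- The pattern with a deadline at `t` enters the demand bound if a job released at `t - D` has its
tightened deadline at or after `ti`. -/
lemma dbfC_le_dbf (τ : MCTask) (hτ : τ.level = Level.HC) {t ti : ℝ} (h : τ.D - τ.DL ≤ t - ti) :
    τ.dbfC t ti ≤ τ.dbf t ti := by
  have h1 : ¬ τ.level = Level.LC := by simp [hτ]
  unfold dbf
  rw [if_neg h1, if_neg (not_lt.2 h)]
  split_ifs
  · exact le_rfl
  · exact le_max_right _ _

lemma dbf_self_nonneg (τ : MCTask) (hτ : τ.level = Level.HC) {t : ℝ} (ht : 0 ≤ t) :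
    0 ≤ τ.dbf t t := by
  refine le_trans ?_ (τ.dbfB_le_dbf hτ (by simpa using τ.D_pos))
  unfold dbfB
  exact add_nonneg (mul_nonneg (τ.floor_nonneg ht) τ.CL_pos.le)
    (τ.dbfJobA_nonneg (τ.floor_mul_le t))

/-- If the task does not switch before the end of the interval, its demand bound covers `CL` units
for each of `n + 1` jobs whose tightened deadlines fit into the interval. -/
lemma mul_CL_le_dbf_self (τ : MCTask) (hτ : τ.level = Level.HC) {t : ℝ} {n : ℕ}
    (h : n * τ.T + τ.DL ≤ t) : (n + 1 : ℝ) * τ.CL ≤ τ.dbf t t := by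
  have hT := τ.T_pos
  have hCL := τ.CL_pos
  have hDL := τ.DL_pos
  refine le_trans ?_ (τ.dbfB_le_dbf hτ (by simpa using τ.D_pos))
  have h1 := τ.floor_mul_le t
  unfold dbfB
  have hn : (n : ℤ) ≤ ⌊t / τ.T⌋ := by
    rw [Int.le_floor, le_div_iff₀ hT]
    push_cast
    linarith
  rcases hn.eq_or_lt with hk | hk
  · have hk' : (⌊t / τ.T⌋ : ℝ) = n := by exact_mod_cast hk.symm
    have : τ.CL ≤ τ.dbfJobA (⌊t / τ.T⌋ * τ.T) t t := by
      unfold dbfJobA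
      rw [hk']
      have := τ.CL_le_CH
      have := τ.CL_le_DL
      split_ifs
      · exact le_rfl
      · linarith
      · exact le_min (by linarith) le_rfl
    rw [← hk'] 
    linarith
  · have hk' : (n : ℝ) + 1 ≤ (⌊t / τ.T⌋ : ℝ) := by exact_mod_cast hk
    have := τ.dbfJobA_nonneg (t := t) h1
    nlinarith

lemma firstRelease_nonneg (τ : MCTask) (t : ℝ) : 0 ≤ τ.firstRelease t := by
  unfold firstRelease
  linarith [τ.floor_mul_le (t - τ.D)]

lemma firstRelease_lt (τ : MCTask) (t : ℝ) : τ.firstRelease t < τ.T := by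
  unfold firstRelease
  linarith [τ.lt_floor_mul (t - τ.D)]

/-- The value `-1` makes `numA` count every job of the pattern if the switch precedes all of them. -/
lemma numB_eq_neg_one (τ : MCTask) {t ti : ℝ} (h0 : 0 ≤ ti) (h : ti < τ.firstRelease t) :
    τ.numB t ti = -1 := by
  have hT := τ.T_pos
  have := τ.firstRelease_lt t
  unfold numB
  rw [Int.floor_eq_iff, le_div_iff₀ hT, div_lt_iff₀ hT]
  push_cast
  constructor <;> linarith

/-- The demand bound with the switch at `ti` dominates every legal pattern of `c` jobs at their LC
execution times, followed by `h + 1` jobs at their HC execution times, the first of which is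
released at `x` and has its tightened deadline after `ti`: shifting the pattern to the right until
its last deadline is `t` gives the pattern of `dbfC`, and only delays releases relative to `ti`. -/
lemma mul_CL_add_mul_CH_le_dbf (τ : MCTask) (hτ : τ.level = Level.HC) {t ti x : ℝ} {c h : ℕ}
    (hti : 0 ≤ ti) (hc : c * τ.T ≤ x) (hh : x + h * τ.T ≤ t - τ.D) (hx : ti < x + τ.DL) :
    c * τ.CL + (h + 1 : ℝ) * τ.CH ≤ τ.dbf t ti := by
  have hT := τ.T_pos
  have hCL := τ.CL_pos
  have hCH := τ.CL_le_CH
  have hDLT : τ.DL ≤ τ.T := τ.DL_le_D.trans τ.D_le_T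
  have hh0 : 0 ≤ (h : ℝ) * τ.T := by positivity
  have hc0 : 0 ≤ (c : ℝ) * τ.T := by positivity
  refine le_trans ?_ (τ.dbfC_le_dbf hτ (by linarith))
  have htD : ¬ t < τ.D := by linarith
  set q := ⌊(t - τ.D) / τ.T⌋ with hq
  have hr0 : τ.firstRelease t = t - τ.D - q * τ.T := rfl
  have hqh : (c : ℝ) + h ≤ q := by
    have : (c + h : ℤ) ≤ q := by
      rw [hq, Int.le_floor, le_div_iff₀ hT]
      push_cast
      linarith
    exact_mod_cast this
  unfold dbfC
  rw [if_neg htD]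
  have hA : τ.numA t ti = q - τ.numB t ti := rfl
  split_ifs with h1
  · rw [hA, τ.numB_eq_neg_one hti h1]
    push_cast
    nlinarith [mul_le_mul_of_nonneg_left hCH (Nat.cast_nonneg (α := ℝ) c)]
  · rw [hA]
    have hb1 : (τ.numB t ti : ℝ) * τ.T ≤ ti - τ.firstRelease t := τ.floor_mul_le _
    set b := τ.numB t ti with hb
    have hb0 : (0 : ℝ) ≤ b := τ.floor_nonneg (by linarith)
    -- `ti < x + DL ≤ r₀ + (q - h) T + T` bounds the number of jobs released by `ti`
    have hbq : (b : ℝ) ≤ q - h := by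
      have : (b : ℝ) < q - h + 1 := by
        by_contra! hcon
        linarith [mul_le_mul_of_nonneg_right hcon hT.le]
      have : b < q - h + 1 := by exact_mod_cast this
      have : b ≤ q - h := by omega
      exact_mod_cast this
    push_cast
    by_cases h2 : τ.firstRelease t + b * τ.T + τ.DL < ti
    · have hA : τ.dbfJobA (τ.firstRelease t + b * τ.T) t ti = τ.CL := by
        unfold dbfJobA
        rw [if_pos h2]
      have hbq' : (b : ℝ) + 1 ≤ q - h := by
        have : (b : ℝ) < q - h := by
          by_contra! hcon
          linarith [mul_le_mul_of_nonneg_right hcon hT.le]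
        have : b < q - h := by exact_mod_cast this
        have : b + 1 ≤ q - h := by omega
        exact_mod_cast this
      rw [hA]
      have e1 := mul_le_mul_of_nonneg_left hCH (sub_nonneg.2 hbq')
      have e2 := mul_le_mul_of_nonneg_right hqh hCL.le
      linarith
    · have hA : τ.dbfJobA (τ.firstRelease t + b * τ.T) t ti = τ.CH := by
        have hh1 : (0 : ℝ) ≤ h := Nat.cast_nonneg h
        have := mul_le_mul_of_nonneg_right hbq hT.le
        unfold dbfJobA
        rw [if_neg h2, if_pos (by linarith)]
      rw [hA]
      have e1 := mul_le_mul_of_nonneg_left hCH (sub_nonneg.2 hbq)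
      have e2 := mul_le_mul_of_nonneg_right hqh hCL.le
      linarith

/-- The demand bound of an LC task that is dropped at `ti` dominates every legal pattern of `m`
complete jobs followed by one that is released at `x` and executes until `ti` at the latest. -/
lemma mul_CL_add_le_dbfA (τ : MCTask) {t ti x w : ℝ} {m : ℕ}
    (hm : m * τ.T ≤ x) (hxt : x + τ.DL ≤ t) (hw : w ≤ ti - x) (hwC : w ≤ τ.CL) (hxi : x ≤ ti) :
    m * τ.CL + w ≤ τ.dbfA t ti := by
  have hT := τ.T_pos
  have hCL := τ.CL_pos
  have h1 := τ.floor_mul_le ti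
  unfold dbfA
  have hn : (m : ℤ) ≤ ⌊ti / τ.T⌋ := by
    rw [Int.le_floor, le_div_iff₀ hT]
    push_cast
    linarith
  rcases hn.eq_or_lt with hk | hk
  · have hk' : (⌊ti / τ.T⌋ : ℝ) = m := by exact_mod_cast hk.symm
    have : w ≤ τ.dbfJobB (⌊ti / τ.T⌋ * τ.T) t ti := by
      unfold dbfJobB
      rw [hk', if_pos (by linarith)]
      exact le_min (by linarith) hwC
    rw [← hk']
    linarith
  · have hk' : (m : ℝ) + 1 ≤ (⌊ti / τ.T⌋ : ℝ) := by exact_mod_cast hk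
    have := τ.dbfJobB_nonneg (t := t) h1
    nlinarith

lemma dbfA_nonneg (τ : MCTask) {t ti : ℝ} (h : 0 ≤ ti) : 0 ≤ τ.dbfA t ti := by
  unfold dbfA
  exact add_nonneg (mul_nonneg (τ.floor_nonneg h) τ.CL_pos.le)
    (τ.dbfJobB_nonneg (τ.floor_mul_le ti))

lemma dbfA_le (τ : MCTask) (t ti : ℝ) : τ.dbfA t ti ≤ τ.CL / τ.T * ti + τ.CL := by
  have hT := τ.T_pos
  have hCL := τ.CL_pos
  have h1 := mul_le_mul_of_nonneg_right (τ.floor_mul_le ti) (div_nonneg hCL.le hT.le)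
  have h2 : τ.dbfJobB (⌊ti / τ.T⌋ * τ.T) t ti ≤ τ.CL := by
    unfold dbfJobB
    split_ifs
    · exact min_le_right _ _
    · exact hCL.le
  have h3 : (⌊ti / τ.T⌋ : ℝ) * τ.T * (τ.CL / τ.T) = ⌊ti / τ.T⌋ * τ.CL := by
    field_simp
  unfold dbfA
  linarith

lemma dbfB_le (τ : MCTask) {t ti : ℝ} :
    τ.dbfB t ti ≤ τ.CL / τ.T * ti + τ.CH := by
  have hT := τ.T_pos
  have hCL := τ.CL_pos
  have h1 := mul_le_mul_of_nonneg_right (τ.floor_mul_le ti) (div_nonneg hCL.le hT.le)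
  have h3 : (⌊ti / τ.T⌋ : ℝ) * τ.T * (τ.CL / τ.T) = ⌊ti / τ.T⌋ * τ.CL := by
    field_simp
  unfold dbfB
  linarith [τ.dbfJobA_le_CH (⌊ti / τ.T⌋ * τ.T) t ti]

lemma dbfC_le (τ : MCTask) {t ti : ℝ} (h0 : 0 ≤ ti) (hti : ti ≤ t) :
    τ.dbfC t ti ≤ τ.CL / τ.T * ti + τ.CH / τ.T * (t - ti)
      + (2 * τ.T - τ.D) * (τ.CH / τ.T) := by
  have hT := τ.T_pos
  have hCL := τ.CL_pos
  have hCH := τ.CH_pos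
  have hLH := τ.CL_le_CH
  have hDT := τ.D_le_T
  unfold dbfC
  set q := ⌊(t - τ.D) / τ.T⌋ with hq
  have hr0 : τ.firstRelease t = t - τ.D - q * τ.T := rfl
  have hA : τ.numA t ti = q - τ.numB t ti := rfl
  have hr1 := τ.firstRelease_nonneg t
  set r₀ := τ.firstRelease t
  obtain ⟨l, hl⟩ : ∃ l, l = τ.CL / τ.T := ⟨_, rfl⟩
  obtain ⟨m, hm⟩ : ∃ m, m = τ.CH / τ.T := ⟨_, rfl⟩
  have hl' : τ.CL = l * τ.T := by rw [hl]; field_simp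
  have hm' : τ.CH = m * τ.T := by rw [hm]; field_simp
  have hl0 : 0 < l := by rw [hl]; positivity
  have hlm : l ≤ m := by rw [hl, hm]; gcongr
  rw [← hl, ← hm]
  split_ifs with h1 h2
  · have : 0 ≤ l * ti := by positivity
    have : 0 ≤ m * (t - ti) := mul_nonneg (by linarith) (by linarith)
    have : 0 ≤ (2 * τ.T - τ.D) * m := mul_nonneg (by linarith) (by linarith)
    linarith
  · rw [hA, τ.numB_eq_neg_one h0 h2]
    have h3 : ti < τ.T := h2.trans (τ.firstRelease_lt t)
    have h4 : (q : ℝ) * τ.T * m = (t - τ.D - r₀) * m := by rw [hr0]; ring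
    have h5 : 0 ≤ m * r₀ := mul_nonneg (by linarith) hr1
    have h6 : m * ti ≤ m * τ.T := mul_le_mul_of_nonneg_left h3.le (by linarith)
    have h7 : 0 ≤ l * ti := by positivity
    push_cast
    rw [hm']
    linarith
  · rw [hA]
    have hb1 : ti - r₀ < ((τ.numB t ti : ℝ) + 1) * τ.T := τ.lt_floor_mul _
    have h8 := τ.dbfJobA_le_CH (r₀ + τ.numB t ti * τ.T) t ti
    generalize τ.dbfJobA (r₀ + τ.numB t ti * τ.T) t ti = A at h8
    generalize τ.numB t ti = b at hb1
    have h4 : (q : ℝ) * τ.T * m = (t - τ.D - r₀) * m := by rw [hr0]; ring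
    have h5 : 0 ≤ l * r₀ := mul_nonneg hl0.le hr1
    have h6 := mul_le_mul_of_nonneg_left hb1.le (sub_nonneg.2 hlm)
    have h7 : 0 < l * τ.T := by positivity
    push_cast
    rw [hl']
    rw [hm'] at h8 ⊢
    linarith

/-- Before and after its switch, an HC task demands at its LC and HC utilization, respectively, up
to a constant. -/
lemma dbf_le (τ : MCTask) (hτ : τ.level = Level.HC) {t ti : ℝ} (h0 : 0 ≤ ti) (hti : ti ≤ t) :
    τ.dbf t ti ≤ τ.CL / τ.T * ti + τ.CH / τ.T * (t - ti)
      + (2 * τ.T - τ.D) * (τ.CH / τ.T) := by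
  have hT := τ.T_pos
  have hC := τ.dbfC_le h0 hti
  have hB : τ.dbfB t ti ≤ τ.CL / τ.T * ti + τ.CH / τ.T * (t - ti)
      + (2 * τ.T - τ.D) * (τ.CH / τ.T) := by
    have h1 := τ.dbfB_le (t := t) (ti := ti)
    have h2 : 0 ≤ τ.CH / τ.T := div_nonneg τ.CH_pos.le hT.le
    have h3 : τ.CH = τ.T * (τ.CH / τ.T) := by field_simp
    have h4 : 0 ≤ τ.CH / τ.T * (t - ti) := mul_nonneg h2 (by linarith)
    have h5 := mul_le_mul_of_nonneg_right τ.D_le_T h2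
    linarith
  have h1 : ¬ τ.level = Level.LC := by simp [hτ]
  unfold dbf
  rw [if_neg h1]
  split_ifs
  · exact hB
  · exact hC
  · exact max_le hB hC

end MCTask

/-! ### Demand of a set of jobs of one task -/

/-- A finite set of reals with gaps of at least `T` in an interval of length `d` has at most
`d / T + 1` elements. -/
lemma card_sub_one_mul_le {T : ℝ} (s : Finset ℝ)
    (hsep : ∀ r ∈ s, ∀ r' ∈ s, r < r' → r + T ≤ r') (a b : ℝ) (hne : s.Nonempty)
    (ha : ∀ r ∈ s, a ≤ r) (hb : ∀ r ∈ s, r ≤ b) : ((s.card : ℝ) - 1) * T ≤ b - a := by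
  induction s using Finset.induction_on_max generalizing b with
  | empty => simp at hne
  | insert x s hx ih =>
    have hxs : x ∉ s := fun h => lt_irrefl _ (hx x h)
    rw [Finset.card_insert_of_notMem hxs]
    have h1 := ha x (Finset.mem_insert_self _ _)
    have h2 := hb x (Finset.mem_insert_self _ _)
    rcases s.eq_empty_or_nonempty with rfl | hs
    · simp
      linarith
    · have := ih (fun r hr r' hr' => hsep r (Finset.mem_insert_of_mem hr) r'
        (Finset.mem_insert_of_mem hr')) (x - T) hs
        (fun r hr => ha r (Finset.mem_insert_of_mem hr))
        (fun r hr => by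
          linarith [hsep r (Finset.mem_insert_of_mem hr) x (Finset.mem_insert_self _ _) (hx r hr)])
      push_cast
      linarith

/-- The variant of `card_sub_one_mul_le` in which the gap after the last element also fits. -/
lemma card_mul_le {T : ℝ} (s : Finset ℝ)
    (hsep : ∀ r ∈ s, ∀ r' ∈ s, r < r' → r + T ≤ r') {a b : ℝ} (hab : a ≤ b)
    (ha : ∀ r ∈ s, a ≤ r) (hb : ∀ r ∈ s, r + T ≤ b) : (s.card : ℝ) * T ≤ b - a := by
  rcases s.eq_empty_or_nonempty with rfl | hs
  · simpa using hab
  · linarith [card_sub_one_mul_le s hsep a (b - T) hs ha (fun r hr => by linarith [hb r hr])]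

section Jobs

variable (τ : MCTask) {t₀ t u : ℝ} {J : Finset ℝ} {w : ℝ → ℝ}

/-- Demand of an HC task of which no job exceeds its LC execution time. -/
lemma sum_le_dbf_self (hτ : τ.level = Level.HC) (ht : t₀ ≤ t)
    (hsep : ∀ r ∈ J, ∀ r' ∈ J, r < r' → r + τ.T ≤ r') (h0 : ∀ r ∈ J, t₀ ≤ r)
    (hDL : ∀ r ∈ J, 0 < w r → r + τ.DL ≤ t) (hCL : ∀ r ∈ J, w r ≤ τ.CL) :
    ∑ r ∈ J, w r ≤ τ.dbf (t - t₀) (t - t₀) := by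
  classical
  set K := J.filter (fun r => 0 < w r) with hK
  have hJK : ∑ r ∈ J, w r ≤ ∑ r ∈ K, w r := by
    rw [hK, Finset.sum_filter]
    exact Finset.sum_le_sum fun r _ => by split_ifs with h <;> linarith
  have hKJ : ∀ r ∈ K, r ∈ J ∧ 0 < w r := fun r hr => Finset.mem_filter.1 hr
  have hcard : ∑ r ∈ K, w r ≤ K.card * τ.CL := by
    have := Finset.sum_le_card_nsmul K w τ.CL (fun r hr => hCL r (hKJ r hr).1)
    simpa using this
  rcases K.eq_empty_or_nonempty with hKe | hKne
  · rw [hKe] at hJK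
    exact hJK.trans (by simpa using τ.dbf_self_nonneg hτ (sub_nonneg.2 ht))
  · obtain ⟨n, hn⟩ : ∃ n, K.card = n + 1 := ⟨K.card - 1, by have := hKne.card_pos; omega⟩
    have h1 := card_sub_one_mul_le K (fun r hr r' hr' => hsep r (hKJ r hr).1 r' (hKJ r' hr').1)
      t₀ (t - τ.DL) hKne (fun r hr => h0 r (hKJ r hr).1)
      (fun r hr => by linarith [hDL r (hKJ r hr).1 (hKJ r hr).2])
    have h2 := τ.mul_CL_le_dbf_self hτ (t := t - t₀) (n := n) (by
      rw [hn] at h1; push_cast at h1; linarith)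
    rw [hn] at hcard
    push_cast at hcard
    linarith

/-- Demand of an HC task that is still in LC mode at `u`: a job that exceeds its LC execution time
has its tightened deadline after `u`, and from its release on all jobs run in HC mode. -/
lemma sum_le_dbf_of_switch (hτ : τ.level = Level.HC) (hu : t₀ ≤ u)
    (hsep : ∀ r ∈ J, ∀ r' ∈ J, r < r' → r + τ.T ≤ r') (h0 : ∀ r ∈ J, t₀ ≤ r)
    (hCH : ∀ r ∈ J, w r ≤ τ.CH)
    (hsw : ∀ r ∈ J, τ.CL < w r → r + τ.D ≤ t ∧ u < r + τ.DL)
    (hafter : ∀ r ∈ J, τ.CL < w r → ∀ r' ∈ J, r < r' → 0 < w r' → r' + τ.D ≤ t)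
    (hex : ∃ r ∈ J, τ.CL < w r) :
    ∑ r ∈ J, w r ≤ τ.dbf (t - t₀) (u - t₀) := by
  classical
  have hT := τ.T_pos
  have hH : (J.filter (fun r => τ.CL < w r)).Nonempty := by
    obtain ⟨r, hr, h⟩ := hex
    exact ⟨r, Finset.mem_filter.2 ⟨hr, h⟩⟩
  set x := (J.filter (fun r => τ.CL < w r)).min' hH with hx
  obtain ⟨hxJ, hxw⟩ := Finset.mem_filter.1 (Finset.min'_mem _ hH)
  rw [← hx] at hxJ hxw
  set A := J.filter (fun r => r < x) with hA
  set B := J.filter (fun r => x ≤ r ∧ 0 < w r) with hB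
  have hAm : ∀ r ∈ A, r ∈ J ∧ r < x := fun r hr => Finset.mem_filter.1 hr
  have hBm : ∀ r ∈ B, r ∈ J ∧ x ≤ r ∧ 0 < w r := fun r hr => Finset.mem_filter.1 hr
  have hsum : ∑ r ∈ J, w r ≤ ∑ r ∈ A, w r + ∑ r ∈ B, w r := by
    rw [hA, hB, Finset.sum_filter, Finset.sum_filter, ← Finset.sum_add_distrib]
    refine Finset.sum_le_sum fun r _ => ?_
    by_cases h1 : r < x
    · rw [if_pos h1, if_neg (by intro h; linarith [h.1])]
      linarith
    · rw [if_neg h1]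
      split_ifs with h2
      · linarith
      · have : ¬ 0 < w r := fun h => h2 ⟨not_lt.1 h1, h⟩
        linarith
  have hAsum : ∑ r ∈ A, w r ≤ A.card * τ.CL := by
    have := Finset.sum_le_card_nsmul A w τ.CL (fun r hr => by
      by_contra! hcon
      have := Finset.min'_le (J.filter (fun r => τ.CL < w r)) r
        (Finset.mem_filter.2 ⟨(hAm r hr).1, hcon⟩)
      linarith [(hAm r hr).2])
    simpa using this
  have hBsum : ∑ r ∈ B, w r ≤ B.card * τ.CH := by
    have := Finset.sum_le_card_nsmul B w τ.CH (fun r hr => hCH r (hBm r hr).1)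
    simpa using this
  have hxB : x ∈ B := Finset.mem_filter.2 ⟨hxJ, le_rfl, τ.CL_pos.trans hxw⟩
  obtain ⟨n, hn⟩ : ∃ n, B.card = n + 1 :=
    ⟨B.card - 1, by have := Finset.card_pos.2 ⟨x, hxB⟩; omega⟩
  have h1 := card_mul_le A (fun r hr r' hr' => hsep r (hAm r hr).1 r' (hAm r' hr').1)
    (h0 x hxJ) (fun r hr => h0 r (hAm r hr).1)
    (fun r hr => hsep r (hAm r hr).1 x hxJ (hAm r hr).2)
  have h2 := card_sub_one_mul_le B (fun r hr r' hr' => hsep r (hBm r hr).1 r' (hBm r' hr').1)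
    x (t - τ.D) ⟨x, hxB⟩ (fun r hr => (hBm r hr).2.1) (fun r hr => by
      rcases (hBm r hr).2.1.eq_or_lt with h | h
      · rw [← h]
        linarith [(hsw x hxJ hxw).1]
      · linarith [hafter x hxJ hxw r (hBm r hr).1 h (hBm r hr).2.2])
  rw [hn] at h2 hBsum
  push_cast at h2 hBsum
  have := τ.mul_CL_add_mul_CH_le_dbf hτ (t := t - t₀) (ti := u - t₀) (x := x - t₀) (c := A.card)
    (h := n) (by linarith) (by linarith) (by linarith) (by linarith [(hsw x hxJ hxw).2])
  linarith

/-- Demand of an LC task that is dropped at `u`. -/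
lemma sum_le_dbfA (hu : t₀ ≤ u)
    (hsep : ∀ r ∈ J, ∀ r' ∈ J, r < r' → r + τ.T ≤ r') (h0 : ∀ r ∈ J, t₀ ≤ r)
    (hDL : ∀ r ∈ J, 0 < w r → r + τ.DL ≤ t) (hCL : ∀ r ∈ J, w r ≤ τ.CL)
    (hdrop : ∀ r ∈ J, 0 < w r → w r ≤ u - r) :
    ∑ r ∈ J, w r ≤ τ.dbfA (t - t₀) (u - t₀) := by
  classical
  set K := J.filter (fun r => 0 < w r) with hK
  have hJK : ∑ r ∈ J, w r ≤ ∑ r ∈ K, w r := by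
    rw [hK, Finset.sum_filter]
    exact Finset.sum_le_sum fun r _ => by split_ifs with h <;> linarith
  have hKJ : ∀ r ∈ K, r ∈ J ∧ 0 < w r := fun r hr => Finset.mem_filter.1 hr
  rcases K.eq_empty_or_nonempty with hKe | hKne
  · rw [hKe] at hJK
    exact hJK.trans (by simpa using τ.dbfA_nonneg (sub_nonneg.2 hu))
  · set x := K.max' hKne with hx
    have hxK : x ∈ K := Finset.max'_mem _ hKne
    obtain ⟨hxJ, hxw⟩ := hKJ x hxK
    have hlt : ∀ r ∈ K.erase x, r ∈ J ∧ r < x := fun r hr =>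
      ⟨(hKJ r (Finset.mem_of_mem_erase hr)).1,
        lt_of_le_of_ne (Finset.le_max' _ _ (Finset.mem_of_mem_erase hr))
          (Finset.ne_of_mem_erase hr)⟩
    have h1 := card_mul_le (K.erase x)
      (fun r hr r' hr' => hsep r (hlt r hr).1 r' (hlt r' hr').1)
      (h0 x hxJ) (fun r hr => h0 r (hlt r hr).1)
      (fun r hr => hsep r (hlt r hr).1 x hxJ (hlt r hr).2)
    have h2 : ∑ r ∈ K.erase x, w r ≤ (K.erase x).card * τ.CL := by
      have := Finset.sum_le_card_nsmul (K.erase x) w τ.CL (fun r hr => hCL r (hlt r hr).1)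
      simpa using this
    rw [← Finset.sum_erase_add _ _ hxK] at hJK
    have := τ.mul_CL_add_le_dbfA (t := t - t₀) (ti := u - t₀) (x := x - t₀) (w := w x)
      (m := (K.erase x).card) (by linarith) (by linarith [hDL x hxJ hxw])
      (by linarith [hdrop x hxJ hxw]) (hCL x hxJ) (by linarith [hdrop x hxJ hxw])
    linarith

end Jobs

/-! ### Supply of the interface -/

section Supply

variable {s : Set ℝ}

lemma measureReal_inter_Ico_add (s : Set ℝ) {a b c : ℝ} (hab : a ≤ b) (hbc : b ≤ c) :
    volume.real (s ∩ Set.Ico a b) + volume.real (s ∩ Set.Ico b c)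
      = volume.real (s ∩ Set.Ico a c) := by
  have hfin : volume (s ∩ Set.Ico a c) ≠ ⊤ :=
    measure_ne_top_of_subset Set.inter_subset_right (by simp)
  rw [← measureReal_inter_add_sdiff (s := s ∩ Set.Ico a c) (t := Set.Ico a b)
    measurableSet_Ico hfin]
  congr 2
  · ext x
    simp only [Set.mem_inter_iff, Set.mem_Ico]
    constructor
    · rintro ⟨h1, h2, h3⟩
      exact ⟨⟨h1, h2, h3.trans_le hbc⟩, h2, h3⟩
    · rintro ⟨⟨h1, _⟩, h2⟩
      exact ⟨h1, h2⟩
  · ext x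
    simp only [Set.mem_inter_iff, Set.mem_Ico, Set.mem_sdiff, not_and, not_lt]
    constructor
    · rintro ⟨h1, h2, h3⟩
      exact ⟨⟨h1, hab.trans h2, h3⟩, fun _ => h2⟩
    · rintro ⟨⟨h1, h2, h3⟩, h4⟩
      exact ⟨h1, h4 h2, h3⟩

lemma measureReal_inter_Ico_le (s : Set ℝ) {a b : ℝ} (hab : a ≤ b) :
    volume.real (s ∩ Set.Ico a b) ≤ b - a := by
  have := measureReal_mono (μ := volume) (Set.inter_subset_right (s := s) (t := Set.Ico a b))
    (by simp)
  rwa [Real.volume_real_Ico_of_le hab] at this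

variable (I : MCPR)

/-- The supply bound function is dominated by the guaranteed supply in an interval that consists of
the end of a period of length `x`, `m` complete periods, and the start of a period of length `y`. -/
lemma sbfLC_le (m : ℕ) {x y : ℝ} (hx0 : 0 ≤ x) (hx : x < I.T) (hy0 : 0 ≤ y) (hy : y < I.T) :
    I.sbfLC (x + m * I.T + y)
      ≤ max 0 (x - (I.T - I.CL)) + m * I.CL + max 0 (y - (I.T - I.CL)) := by
  have hT := I.T_pos
  have hC := I.CL_nonneg
  have hCT : I.CL ≤ I.T := I.CL_le_CH.trans I.CH_le_T
  have ex1 := le_max_left 0 (x - (I.T - I.CL))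
  have ex2 := le_max_right 0 (x - (I.T - I.CL))
  have ey1 := le_max_left 0 (y - (I.T - I.CL))
  have ey2 := le_max_right 0 (y - (I.T - I.CL))
  have key : ∀ n : ℝ, n * I.CL ≤ max 0 (x - (I.T - I.CL)) + m * I.CL
        + max 0 (y - (I.T - I.CL)) →
      n * I.CL + (x + m * I.T + y - 2 * (I.T - I.CL) - n * I.T)
        ≤ max 0 (x - (I.T - I.CL)) + m * I.CL + max 0 (y - (I.T - I.CL)) →
      n * I.CL + max 0 (x + m * I.T + y - 2 * (I.T - I.CL) - n * I.T)
      ≤ max 0 (x - (I.T - I.CL)) + m * I.CL + max 0 (y - (I.T - I.CL)) := by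
    intro n h1 h2
    rcases max_cases 0 (x + m * I.T + y - 2 * (I.T - I.CL) - n * I.T) with h | h <;>
      rw [h.1] <;> linarith
  unfold MCPR.sbfLC
  simp only
  set f := ⌊(x + m * I.T + y - (I.T - I.CL)) / I.T⌋ with hf
  -- `f` is `m - 1`, `m` or `m + 1`, according to the position of `x + y` relative to `T - CL` and
  -- `2 T - CL`; both goals of `key` are linear then
  apply key
  all_goals
    rcases lt_or_ge (x + y) (I.T - I.CL) with h1 | h1
    · have hfm : (f : ℝ) ≤ m - 1 := by
        have : f < m := by
          rw [hf, Int.floor_lt, div_lt_iff₀ hT]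
          push_cast
          linarith
        have : f ≤ m - 1 := by omega
        exact_mod_cast this
      rcases Nat.eq_zero_or_pos m with rfl | hm
      · rw [max_eq_left (by push_cast at hfm ⊢; linarith)]
        push_cast
        linarith
      · have hm1 : (1 : ℝ) ≤ m := by exact_mod_cast hm
        have hfm' : (f : ℝ) = m - 1 := by
          refine le_antisymm hfm ?_
          have : (m : ℤ) - 1 ≤ f := by
            rw [hf, Int.le_floor, le_div_iff₀ hT]
            push_cast
            linarith
          exact_mod_cast this
        rw [max_eq_right (by linarith), hfm']
        linarith
    · rcases lt_or_ge (x + y) (I.T - I.CL + I.T) with h2 | h2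
      · have hfm : (f : ℝ) = m := by
          have : f = (m : ℤ) := by
            rw [hf, Int.floor_eq_iff, le_div_iff₀ hT, div_lt_iff₀ hT]
            push_cast
            constructor <;> linarith
          exact_mod_cast this
        rw [max_eq_right (by rw [hfm]; positivity), hfm]
        linarith
      · have hfm : (f : ℝ) = m + 1 := by
          have : f = (m : ℤ) + 1 := by
            rw [hf, Int.floor_eq_iff, le_div_iff₀ hT, div_lt_iff₀ hT]
            push_cast
            constructor <;> linarith
          exact_mod_cast this
        rw [max_eq_right (by rw [hfm]; positivity), hfm]
        linarith

/-- The interface supplies at least `sbfLC` in every interval. -/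
lemma sbfLC_le_supply {φ : ℝ} (hper : ∀ k : ℤ, ENNReal.ofReal I.CL ≤
      volume (s ∩ Set.Ico (φ + k * I.T) (φ + (k + 1) * I.T))) {a b : ℝ} (hab : a ≤ b) :
    I.sbfLC (b - a) ≤ volume.real (s ∩ Set.Ico a b) := by
  have hT := I.T_pos
  have hC := I.CL_nonneg
  have hCT : I.CL ≤ I.T := I.CL_le_CH.trans I.CH_le_T
  have hper' : ∀ k : ℤ, I.CL ≤
      volume.real (s ∩ Set.Ico (φ + k * I.T) (φ + (k + 1) * I.T)) := fun k =>
    (ENNReal.ofReal_le_iff_le_toReal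
      (measure_ne_top_of_subset Set.inter_subset_right (by simp))).1 (hper k)
  -- at most `T - CL` units of a period lack supply
  have hpart : ∀ (k : ℤ) (c d : ℝ), φ + k * I.T ≤ c → c ≤ d → d ≤ φ + (k + 1) * I.T →
      max 0 (d - c - (I.T - I.CL)) ≤ volume.real (s ∩ Set.Ico c d) := by
    intro k c d hc hcd hd
    refine max_le measureReal_nonneg ?_
    have h1 := measureReal_inter_Ico_add s hc (hcd.trans hd)
    have h2 := measureReal_inter_Ico_add s hcd hd
    linarith [hper' k, measureReal_inter_Ico_le s hc, measureReal_inter_Ico_le s hd]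
  have hfull : ∀ (k : ℤ) (m : ℕ), m * I.CL ≤
      volume.real (s ∩ Set.Ico (φ + k * I.T) (φ + k * I.T + m * I.T)) := by
    intro k m
    induction m with
    | zero => simp
    | succ m ih =>
      have h1 : φ + k * I.T + m * I.T ≤ φ + k * I.T + (m + 1 : ℕ) * I.T := by
        push_cast
        linarith
      have h2 := measureReal_inter_Ico_add s
        (by linarith [mul_nonneg (Nat.cast_nonneg (α := ℝ) m) hT.le] :
          φ + k * I.T ≤ φ + k * I.T + m * I.T) h1
      have h3 := hper' (k + m)
      have e1 : φ + ((k + m : ℤ) : ℝ) * I.T = φ + k * I.T + m * I.T := by push_cast; ring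
      have e2 : φ + (((k + m : ℤ) : ℝ) + 1) * I.T = φ + k * I.T + (m + 1 : ℕ) * I.T := by
        push_cast; ring
      rw [e1, e2] at h3
      push_cast at h2 h3 ⊢
      linarith
  -- `φ + k * T` is the first start of a period in `[a, ∞)`
  set k := ⌈(a - φ) / I.T⌉ with hk
  have hk1 : a ≤ φ + k * I.T := by
    have := Int.le_ceil ((a - φ) / I.T)
    rw [div_le_iff₀ hT] at this
    linarith
  have hk2 : φ + k * I.T < a + I.T := by
    have := Int.ceil_lt_add_one ((a - φ) / I.T)
    rw [← hk, ← sub_lt_iff_lt_add, lt_div_iff₀ hT] at this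
    linarith
  have hkm : φ + ((k - 1 : ℤ) : ℝ) * I.T = φ + k * I.T - I.T := by push_cast; ring
  have hkm' : φ + (((k - 1 : ℤ) : ℝ) + 1) * I.T = φ + k * I.T := by push_cast; ring
  rcases lt_or_ge b (φ + k * I.T) with hb | hb
  · have h1 := hpart (k - 1) a b (by linarith) hab (by linarith)
    have h2 := sbfLC_le I 0 (x := b - a) (y := 0) (by linarith) (by linarith) le_rfl hT
    rw [max_eq_left (by linarith : 0 - (I.T - I.CL) ≤ 0)] at h2
    simp only [Nat.cast_zero, zero_mul, add_zero] at h2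
    exact h2.trans h1
  · set m := ⌊(b - (φ + k * I.T)) / I.T⌋₊ with hm
    have hm1 : m * I.T ≤ b - (φ + k * I.T) := by
      have := Nat.floor_le (div_nonneg (sub_nonneg.2 hb) hT.le)
      rwa [le_div_iff₀ hT] at this
    have hm2 : b - (φ + k * I.T) < (m + 1) * I.T := by
      have := Nat.lt_floor_add_one ((b - (φ + k * I.T)) / I.T)
      rwa [div_lt_iff₀ hT] at this
    have e1 : φ + ((k + m : ℤ) : ℝ) * I.T = φ + k * I.T + m * I.T := by push_cast; ring
    have e2 : φ + (((k + m : ℤ) : ℝ) + 1) * I.T = φ + k * I.T + (m + 1) * I.T := by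
      push_cast; ring
    have hm0 : 0 ≤ m * I.T := by positivity
    have h1 := hpart (k - 1) a (φ + k * I.T) (by linarith) hk1 (by linarith)
    have h2 := hfull k m
    have h3 := hpart (k + m) (φ + k * I.T + m * I.T) b (by linarith) (by linarith) (by linarith)
    have h4 := measureReal_inter_Ico_add s hk1 (by linarith : φ + k * I.T ≤ φ + k * I.T + m * I.T)
    have h5 := measureReal_inter_Ico_add s (by linarith : a ≤ φ + k * I.T + m * I.T)
      (by linarith : φ + k * I.T + m * I.T ≤ b)
    have h6 := sbfLC_le I m (x := φ + k * I.T - a) (y := b - (φ + k * I.T + m * I.T))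
      (by linarith) (by linarith) (by linarith) (by linarith)
    have e3 : φ + k * I.T - a + m * I.T + (b - (φ + k * I.T + m * I.T)) = b - a := by ring
    rw [e3] at h6
    linarith

/-- The supply bound function lies above the line whose slope is the bandwidth of the interface. -/
lemma le_sbfLC (t : ℝ) : I.CL / I.T * (t - 2 * (I.T - I.CL)) ≤ I.sbfLC t := by
  have hT := I.T_pos
  have hC := I.CL_nonneg
  have hCT : I.CL ≤ I.T := I.CL_le_CH.trans I.CH_le_T
  obtain ⟨g, hg⟩ : ∃ g, g = I.CL / I.T := ⟨_, rfl⟩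
  have hg0 : 0 ≤ g := by rw [hg]; positivity
  have hg1 : g ≤ 1 := by rw [hg, div_le_one hT]; exact hCT
  have hgC : I.CL = g * I.T := by rw [hg]; field_simp
  unfold MCPR.sbfLC
  simp only
  rw [← hg]
  set f := ⌊(t - (I.T - I.CL)) / I.T⌋ with hf
  rcases lt_or_ge f 0 with h | h
  · have h1 : t - (I.T - I.CL) < 0 := by
      rw [hf, Int.floor_lt, div_lt_iff₀ hT] at h
      simpa using h
    rw [max_eq_left (by exact_mod_cast h.le)]
    have := le_max_left 0 (t - 2 * (I.T - I.CL) - 0 * I.T)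
    have h2 := mul_nonneg hg0 (by linarith : 0 ≤ -(t - 2 * (I.T - I.CL)))
    linarith
  · rw [max_eq_right (by exact_mod_cast h)]
    have h3 : f * I.CL = g * (f * I.T) := by rw [hgC]; ring
    rw [h3]
    obtain ⟨y, hy⟩ : ∃ y, y = t - 2 * (I.T - I.CL) - f * I.T := ⟨_, rfl⟩
    rw [← hy]
    have h4 : g * y ≤ max 0 y := by
      rcases le_total 0 y with h0 | h0
      · rw [max_eq_right h0]
        exact mul_le_of_le_one_left h0 hg1
      · rw [max_eq_left h0]
        exact mul_nonpos_of_nonneg_of_nonpos hg0 h0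
    have h5 : t - 2 * (I.T - I.CL) = y + f * I.T := by rw [hy]; ring
    rw [h5]
    linarith

end Supply

/-! ### Growth of demand and supply -/

section TopSum
variable {ι : Type*} {s : Finset ι} {k : ℕ} {f : ι → ℝ}

lemma sum_le_topSum {G : Finset ι} (hG : G ⊆ s) (hk : G.card ≤ k) :
    ∑ i ∈ G, f i ≤ topSum s k f := by
  unfold topSum
  exact Finset.le_sup' (fun G => ∑ i ∈ G, f i)
    (Finset.mem_filter.2 ⟨Finset.mem_powerset.2 hG, hk⟩)

lemma topSum_le {c : ℝ} (h : ∀ G ⊆ s, G.card ≤ k → ∑ i ∈ G, f i ≤ c) :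
    topSum s k f ≤ c := by
  unfold topSum
  refine Finset.sup'_le _ _ fun G hG => ?_
  rw [Finset.mem_filter, Finset.mem_powerset] at hG
  exact h G hG.1 hG.2

end TopSum

variable {ι : Type*} [Fintype ι] (C : Component ι) (I : MCPR)

lemma Component.level_of_mem_hcTasks {C : Component ι} {i : ι} (h : i ∈ C.hcTasks) :
    (C.task i).level = Level.HC := (Finset.mem_filter.1 h).2

lemma Component.level_of_mem_lcTasks {C : Component ι} {i : ι} (h : i ∈ C.lcTasks) :
    (C.task i).level = Level.LC := (Finset.mem_filter.1 h).2

lemma Component.dbf_of_mem_lcTasks {C : Component ι} {i : ι} (h : i ∈ C.lcTasks) (t ti : ℝ) :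
    (C.task i).dbf t ti = (C.task i).dbfA t ti := by
  unfold MCTask.dbf
  rw [if_pos (Component.level_of_mem_lcTasks h)]

/-- The demand of a component grows at its long-run rate, up to a constant. -/
lemma Component.dbf_le_rate {t tI : ℝ} (h0 : 0 ≤ tI) (ht : tI ≤ t) :
    C.dbf t t tI ≤ C.rate * t
      + ∑ i ∈ C.hcTasks, (2 * (C.task i).T - (C.task i).D) * ((C.task i).CH / (C.task i).T)
      + ∑ i ∈ C.lcTasks, (C.task i).CL := by
  classical
  set U := ∑ i ∈ C.lcTasks, (C.task i).CL / (C.task i).T with hU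
  set V := topSum C.hcTasks C.TL
    (fun i => ((C.task i).CH - (C.task i).CL) / (C.task i).T) with hV
  set H := ∑ i ∈ C.hcTasks, (C.task i).CL / (C.task i).T with hH
  set κ : ι → ℝ := fun i => (2 * (C.task i).T - (C.task i).D) * ((C.task i).CH / (C.task i).T)
    with hκ
  have hlc : ∑ i ∈ C.lcTasks, (C.task i).dbf t tI ≤ U * tI + ∑ i ∈ C.lcTasks, (C.task i).CL := by
    rw [hU, Finset.sum_mul, ← Finset.sum_add_distrib]
    exact Finset.sum_le_sum fun i hi => by
      rw [Component.dbf_of_mem_lcTasks hi]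
      exact (C.task i).dbfA_le t tI
  have hhc : topSum C.hcTasks C.TL (C.delta t t tI)
      ≤ H * t + V * (t - tI) + ∑ i ∈ C.hcTasks, κ i - ∑ i ∈ C.hcTasks, (C.task i).dbf t t := by
    refine topSum_le fun G hG hGk => ?_
    have h1 : ∑ i ∈ G, ((C.task i).CH - (C.task i).CL) / (C.task i).T ≤ V := sum_le_topSum hG hGk
    have h2 := mul_le_mul_of_nonneg_right h1 (sub_nonneg.2 ht)
    have h3 : ∑ i ∈ C.hcTasks, ((C.task i).dbf t t + if i ∈ G then C.delta t t tI i else 0)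
        ≤ ∑ i ∈ C.hcTasks, ((C.task i).CL / (C.task i).T * t + κ i
          + if i ∈ G then ((C.task i).CH - (C.task i).CL) / (C.task i).T * (t - tI) else 0) := by
      refine Finset.sum_le_sum fun i hi => ?_
      have hl := Component.level_of_mem_hcTasks hi
      have e1 := (C.task i).dbf_le hl (h0.trans ht) le_rfl
      have e2 := (C.task i).dbf_le hl h0 ht
      have e3 : 0 ≤ ((C.task i).CH - (C.task i).CL) / (C.task i).T * (t - tI) :=
        mul_nonneg (div_nonneg (sub_nonneg.2 (C.task i).CL_le_CH) (C.task i).T_pos.le)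
          (sub_nonneg.2 ht)
      simp only [hκ, Component.delta]
      rw [sub_div] at e3 ⊢
      split_ifs
      · rw [add_comm, ← le_sub_iff_add_le]
        exact max_le (by linarith) (by linarith)
      · linarith
    rw [Finset.sum_add_distrib, Finset.sum_add_distrib, Finset.sum_add_distrib, ← Finset.sum_mul,
      Finset.sum_ite_mem, Finset.sum_ite_mem, Finset.inter_eq_right.2 hG, ← Finset.sum_mul] at h3
    linarith
  have hrate : C.rate = H + max U V := rfl
  have h1 := mul_le_mul_of_nonneg_right (le_max_left U V) h0
  have h2 := mul_le_mul_of_nonneg_right (le_max_right U V) (sub_nonneg.2 ht)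
  unfold Component.dbf
  rw [hrate]
  linarith

/-- Beyond `tMAX` the demand is covered by the supply because of the difference of their rates. -/
lemma dbf_le_sbfLC_of_tMAX_lt {t tI : ℝ} (h0 : 0 ≤ tI) (ht : tI ≤ t)
    (h : tMAX C I < (t : EReal)) : C.dbf t t tI ≤ I.sbfLC t := by
  unfold tMAX at h
  split_ifs at h with hs
  · rw [EReal.coe_lt_coe_iff, div_lt_iff₀ hs] at h
    have h1 := C.dbf_le_rate h0 ht
    have h2 := le_sbfLC I t
    unfold slack at h
    linarith
  · simp at h

lemma tMAX_le {M : ℝ} (hs : 0 < slack C I) (hI : I.T ≤ M)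
    (hM : ∀ i, (C.task i).T ≤ M ∧ (C.task i).CH ≤ M) :
    tMAX C I ≤ ((2 * (Fintype.card ι + 1) * M / slack C I : ℝ) : EReal) := by
  classical
  unfold tMAX
  rw [if_pos hs, EReal.coe_le_coe_iff]
  refine div_le_div_of_nonneg_right ?_ hs.le
  have hT := I.T_pos
  have hCT : I.CL ≤ I.T := I.CL_le_CH.trans I.CH_le_T
  have h1 : ∑ i ∈ C.hcTasks, (2 * (C.task i).T - (C.task i).D) * ((C.task i).CH / (C.task i).T)
      ≤ C.hcTasks.card * (2 * M) := by
    rw [← nsmul_eq_mul]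
    refine Finset.sum_le_card_nsmul _ _ _ fun i _ => ?_
    have hCH := (C.task i).CH_pos
    have hTi := (C.task i).T_pos
    have hD := (C.task i).D_pos
    have e : (2 * (C.task i).T - (C.task i).D) * ((C.task i).CH / (C.task i).T)
        ≤ 2 * (C.task i).T * ((C.task i).CH / (C.task i).T) :=
      mul_le_mul_of_nonneg_right (by linarith) (by positivity)
    have e2 : 2 * (C.task i).T * ((C.task i).CH / (C.task i).T) = 2 * (C.task i).CH := by
      field_simp
    linarith [(hM i).2]
  have h2 : ∑ i ∈ C.lcTasks, (C.task i).CL ≤ C.lcTasks.card * (2 * M) := by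
    rw [← nsmul_eq_mul]
    refine Finset.sum_le_card_nsmul _ _ _ fun i _ => ?_
    linarith [(C.task i).CL_le_CH, (hM i).2, (C.task i).CL_pos]
  have h3 : 2 * (I.CL / I.T) * (I.T - I.CL) ≤ 2 * M := by
    have e1 : I.CL / I.T ≤ 1 := (div_le_one hT).2 hCT
    have := mul_le_mul_of_nonneg_right e1 (sub_nonneg.2 hCT)
    linarith [I.CL_nonneg]
  have h4 : (C.hcTasks.card : ℝ) + C.lcTasks.card ≤ Fintype.card ι := by
    have hd : Disjoint C.hcTasks C.lcTasks := Finset.disjoint_left.2 fun i hi hi' => by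
      have := Component.level_of_mem_hcTasks hi
      rw [Component.level_of_mem_lcTasks hi'] at this
      cases this
    have := Finset.card_le_univ (C.hcTasks ∪ C.lcTasks)
    rw [Finset.card_union_of_disjoint hd] at this
    exact_mod_cast this
  have h5 := mul_le_mul_of_nonneg_right h4 (by linarith : 0 ≤ 2 * M)
  linarith

/-! ### Executions and busy periods -/

namespace Trace

section Basic

variable {ι : Type*} {X : Trace ι} {C : Component ι}

lemma exec_mono {i : ι} {r a b : ℝ} (h : a ≤ b) : X.exec i r a ≤ X.exec i r b :=
  measureReal_mono (Set.inter_subset_inter_right _ (Set.Icc_subset_Icc_right h))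
    (measure_ne_top_of_subset Set.inter_subset_right (by simp))

lemma exec_le_add {i : ι} {r a b : ℝ} (h : a ≤ b) :
    X.exec i r b ≤ X.exec i r a + (b - a) := by
  have h1 : X.run i r ∩ Set.Icc r b ⊆ X.run i r ∩ Set.Icc r a ∪ Set.Icc a b := by
    rintro x ⟨h1, h2, h3⟩
    rcases le_total x a with hx | hx
    · exact Or.inl ⟨h1, h2, hx⟩
    · exact Or.inr ⟨hx, h3⟩
  have h2 := measureReal_mono (μ := volume) h1 (measure_union_ne_top
    (measure_ne_top_of_subset Set.inter_subset_right (by simp)) (by simp))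
  have h3 := measureReal_union_le (μ := volume) (X.run i r ∩ Set.Icc r a) (Set.Icc a b)
  rw [Real.volume_real_Icc_of_le h] at h3
  exact h2.trans h3

/-- A job that has received at most `c` units of execution whenever it executes at a time in `S`
executes for at most `c` units of time in `S`. -/
lemma measureReal_le_of_exec_le {i : ι} {r c t : ℝ} {S : Set ℝ} (hc : 0 ≤ c)
    (hS : S ⊆ X.run i r) (ht : ∀ x ∈ S, x ≤ t) (h : ∀ x ∈ S, r ≤ x ∧ X.exec i r x ≤ c) :
    volume.real S ≤ c := by
  rcases S.eq_empty_or_nonempty with rfl | hne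
  · simpa using hc
  have hb : BddAbove S := ⟨t, ht⟩
  have h1 : volume.real S ≤ X.exec i r (sSup S) :=
    measureReal_mono (fun x hx => ⟨hS hx, (h x hx).1, le_csSup hb hx⟩)
      (measure_ne_top_of_subset Set.inter_subset_right (by simp))
  refine h1.trans (le_of_forall_pos_le_add fun ε hε => ?_)
  obtain ⟨x, hx, hlt⟩ := exists_lt_of_lt_csSup hne (sub_lt_self (sSup S) hε)
  have := X.exec_le_add (i := i) (r := r) (le_csSup hb hx)
  linarith [(h x hx).2]

lemma InHC.mono {i : ι} {a b : ℝ} (h : X.InHC C i a) (hab : a ≤ b) : X.InHC C i b := by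
  obtain ⟨hl, r, hr, hra, hc, he⟩ := h
  exact ⟨hl, r, hr, hra.trans hab, hc, he.trans (exec_mono hab)⟩

lemma IMS.mono {a b : ℝ} (h : X.IMS C a) (hab : a ≤ b) : X.IMS C b := by
  obtain ⟨i, hi⟩ := h
  exact ⟨i, hi.mono hab⟩

lemma EMS.mono [Finite ι] {a b : ℝ} (h : X.EMS C a) (hab : a ≤ b) : X.EMS C b :=
  lt_of_lt_of_le h (Set.ncard_le_ncard (fun _ hi => InHC.mono hi hab) (Set.toFinite _))

lemma Dropped.mono {i : ι} {a b : ℝ} (h : X.Dropped C i a) (hab : a ≤ b) : X.Dropped C i b :=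
  ⟨h.1, h.2.imp (fun h => h.mono hab) (fun h => h.trans (EReal.coe_le_coe_iff.2 hab))⟩

lemma deadline_mono {i : ι} {r a b : ℝ} (hab : a ≤ b) :
    X.deadline C i r a ≤ X.deadline C i r b := by
  unfold deadline
  have := (C.task i).DL_le_D
  split_ifs with h1 h2
  · exact le_rfl
  · exact absurd (h1.mono hab) h2
  · linarith
  · exact le_rfl

lemma add_DL_le_deadline (i : ι) (r t : ℝ) : r + (C.task i).DL ≤ X.deadline C i r t := by
  unfold deadline
  have := (C.task i).DL_le_D
  split_ifs <;> linarith

lemma deadline_of_InHC {i : ι} {r t : ℝ} (h : X.InHC C i t) :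
    X.deadline C i r t = r + (C.task i).D := if_pos h

lemma deadline_of_not_InHC {i : ι} {r t : ℝ} (h : ¬ X.InHC C i t) :
    X.deadline C i r t = r + (C.task i).DL := if_neg h

lemma Pending.of_le {i : ι} {r a b : ℝ} (h : X.Pending C i r b) (hra : r ≤ a) (hab : a ≤ b) :
    X.Pending C i r a :=
  ⟨h.1, hra, (exec_mono hab).trans_lt h.2.2.1, fun hd => h.2.2.2 (hd.mono hab)⟩

/-- Some pending job has its deadline in force at or before `t`. -/
def Urgent (X : Trace ι) (C : Component ι) (t x : ℝ) : Prop :=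
  ∃ i r, X.Pending C i r x ∧ X.deadline C i r x ≤ t

/-- The times in `(a, t)` at which job `(i, r)` executes, is pending, and has its deadline in
force at or before `t`. -/
def urgentRun (X : Trace ι) (C : Component ι) (a t : ℝ) (i : ι) (r : ℝ) : Set ℝ :=
  {x ∈ X.run i r | a < x ∧ x < t ∧ X.Pending C i r x ∧ X.deadline C i r x ≤ t}

end Basic

section Run

variable {ι : Type*} {X : Trace ι} {C : Component ι} {I : MCPR}

lemma IsRun.cost_le_CL (hX : X.IsRun C I) {i : ι} {r : ℝ} (hr : r ∈ X.release i)
    (hl : (C.task i).level = Level.LC) : X.cost i r ≤ (C.task i).CL := by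
  rw [(C.task i).CH_of_LC hl]
  exact hX.cost_le i r hr

/-- Before the switch of its task, a pending job has not exceeded its LC execution time. -/
lemma IsRun.exec_lt_CL (hX : X.IsRun C I) {i : ι} {r x : ℝ} (hr : r ∈ X.release i) (hrx : r ≤ x)
    (he : X.exec i r x < X.cost i r) (h : ¬ X.InHC C i x) : X.exec i r x < (C.task i).CL := by
  by_contra! hcon
  cases hl : (C.task i).level with
  | LC => exact absurd (hX.cost_le_CL hr hl) (by linarith)
  | HC => exact h ⟨hl, r, hr, hrx, hcon.trans_lt he, hcon⟩

/-- A job that needs more than its LC execution time has triggered the switch of its task by its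
tightened deadline, if it does not miss this deadline. -/
lemma InHC_of_CL_lt_cost {i : ι} {r : ℝ} (hl : (C.task i).level = Level.HC)
    (hr : r ∈ X.release i) (hc : (C.task i).CL < X.cost i r)
    (hm : X.MeetsDeadlinesAt C (r + (C.task i).DL)) : X.InHC C i (r + (C.task i).DL) := by
  by_contra hcon
  have hd : ¬ X.Dropped C i (r + (C.task i).DL) := fun h => by
    have := h.1
    rw [hl] at this
    cases this
  have := hm i r hr hd (deadline_of_not_InHC hcon)
  exact hcon ⟨hl, r, hr, by linarith [(C.task i).DL_pos], hc, hc.le.trans this⟩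

lemma measureReal_urgentRun_le_cost {a t : ℝ} (hX : X.IsRun C I) {i : ι} {r : ℝ}
    (hr : r ∈ X.release i) : volume.real (X.urgentRun C a t i r) ≤ X.cost i r :=
  measureReal_le_of_exec_le (hX.cost_nonneg i r hr) (fun _ hx => hx.1) (fun _ hx => hx.2.2.1.le)
    (fun _ hx => ⟨hx.2.2.2.1.2.1, hx.2.2.2.1.2.2.1.le⟩)

lemma measureReal_urgentRun_le_CL {a t : ℝ} (hX : X.IsRun C I) {i : ι} {r : ℝ}
    (h : ∀ x ∈ X.urgentRun C a t i r, ¬ X.InHC C i x) :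
    volume.real (X.urgentRun C a t i r) ≤ (C.task i).CL :=
  measureReal_le_of_exec_le (C.task i).CL_pos.le (fun _ hx => hx.1) (fun _ hx => hx.2.2.1.le)
    (fun x hx => ⟨hx.2.2.2.1.2.1,
      (hX.exec_lt_CL hx.2.2.2.1.1 hx.2.2.2.1.2.1 hx.2.2.2.1.2.2.1 (h x hx)).le⟩)

lemma urgentRun_ne_top {a t : ℝ} (i : ι) (r : ℝ) : volume (X.urgentRun C a t i r) ≠ ⊤ :=
  by
  have h : X.urgentRun C a t i r ⊆ Set.Icc a t := fun _ hx => ⟨hx.2.1.le, hx.2.2.1.le⟩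
  exact measure_ne_top_of_subset h (by simp)

lemma IsRun.finite_release (hX : X.IsRun C I) (i : ι) (t : ℝ) :
    {r ∈ X.release i | r ≤ t}.Finite := by
  have hT := (C.task i).T_pos
  refine Set.Finite.of_finite_image (f := fun r => ⌊r / (C.task i).T⌋₊)
    ((Set.finite_Iic ⌊t / (C.task i).T⌋₊).subset ?_) ?_
  · rintro _ ⟨r, hr, rfl⟩
    exact Nat.floor_le_floor (div_le_div_of_nonneg_right hr.2 hT.le)
  · have key : ∀ r ∈ X.release i, ∀ r' ∈ X.release i, r < r' →
        ⌊r / (C.task i).T⌋₊ < ⌊r' / (C.task i).T⌋₊ := by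
      intro r hr r' hr' hlt
      have h1 := hX.separation i r hr r' hr' hlt
      rw [← Nat.succ_le_iff, Nat.succ_eq_add_one, Nat.le_floor_iff
        (div_nonneg (hX.release_nonneg i r' hr') hT.le), le_div_iff₀ hT]
      have h2 := Nat.floor_le (div_nonneg (hX.release_nonneg i r hr) hT.le)
      rw [le_div_iff₀ hT] at h2
      push_cast
      linarith
    intro r hr r' hr' heq
    rcases lt_trichotomy r r' with h | h | h
    · exact absurd heq (key r hr.1 r' hr'.1 h).ne
    · exact h
    · exact absurd heq (key r' hr'.1 r hr.1 h).ne'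

/-- The start `a` of the busy period that precedes a deadline miss at `t`: from `a` to `t` there
always is an urgent job, and urgent jobs are not released before `a`. -/
lemma IsRun.exists_busy_start (hX : X.IsRun C I) {i₀ : ι} {r₀ t : ℝ}
    (hp : X.Pending C i₀ r₀ t) (hd : X.deadline C i₀ r₀ t ≤ t) :
    ∃ a ≤ r₀, (∀ x, a < x → x < t → X.Urgent C t x) ∧
      ∀ i r x, a < x → x < t → X.Pending C i r x → X.deadline C i r x ≤ t → a ≤ r := by
  -- the infimum of `S` is the start: a job that is urgent after it is so from its release on
  set S := {a : ℝ | ∀ x, a ≤ x → x < t → X.Urgent C t x} with hS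
  have hb : BddBelow S := by
    refine ⟨min 0 t, fun a ha => ?_⟩
    by_contra! hcon
    obtain ⟨i, r, h, -⟩ := ha a le_rfl (hcon.trans_le (min_le_right _ _))
    linarith [hX.release_nonneg i r h.1, h.2.1, min_le_left 0 t]
  have h0 : r₀ ∈ S := fun x hx hxt =>
    ⟨i₀, r₀, hp.of_le hx hxt.le, (deadline_mono hxt.le).trans hd⟩
  have h1 : ∀ x, sInf S < x → x < t → X.Urgent C t x := by
    intro x hx hxt
    obtain ⟨a, ha, hax⟩ := exists_lt_of_csInf_lt ⟨r₀, h0⟩ hx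
    exact ha x hax.le hxt
  refine ⟨sInf S, csInf_le hb h0, h1, fun i r x hx hxt hpx hdx => csInf_le hb fun y hy hyt => ?_⟩
  rcases le_total y x with h | h
  · exact ⟨i, r, hpx.of_le hy h, (deadline_mono h).trans hdx⟩
  · exact h1 y (hx.trans_le h) hyt

/-- A time `u` shortly before the first internal mode switch after `a`, or `u = t` if there is none
by time `t`. -/
lemma exists_before_IMS (X : Trace ι) (C : Component ι) {a t ε : ℝ} (hat : a ≤ t) (hε : 0 < ε) :
    ∃ u, a ≤ u ∧ u ≤ t ∧ (u = a ∨ ¬ X.IMS C u) ∧ (u = t ∨ X.IMS C t) ∧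
      ∀ x, u + ε < x → x < t → X.IMS C x := by
  by_cases ht : X.IMS C t
  · set S := {x | a ≤ x ∧ X.IMS C x} with hS
    have hb : BddBelow S := ⟨a, fun x hx => hx.1⟩
    have htS : t ∈ S := ⟨hat, ht⟩
    have hst : sInf S ≤ t := csInf_le hb htS
    refine ⟨max a (sInf S - ε / 2), le_max_left _ _, max_le hat (by linarith), ?_, Or.inr ht, ?_⟩
    · rcases le_total (sInf S - ε / 2) a with h | h
      · exact Or.inl (max_eq_left h)
      · rw [max_eq_right h]
        exact Or.inr fun hI => by linarith [csInf_le hb (⟨h, hI⟩ : sInf S - ε / 2 ∈ S)]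
    · intro x hx _
      have := le_max_right a (sInf S - ε / 2)
      obtain ⟨y, hy, hyx⟩ := exists_lt_of_csInf_lt ⟨t, htS⟩ (by linarith : sInf S < x)
      exact hy.2.mono hyx.le
  · exact ⟨t, hat, le_rfl, Or.inr ht, Or.inl rfl, fun x hx hxt => by linarith⟩

end Run
end Trace

/-! ### Demand of an execution -/

namespace Trace

variable {ι : Type*} {X : Trace ι} {C : Component ι} {I : MCPR}

/-- The constraints on the demand `w i r` of job `(i, r)` in the interval from `a` to `t`, if LC
tasks are only accounted for until `u`. -/
structure IsDemand (X : Trace ι) (C : Component ι) (a u t : ℝ) (w : ι → ℝ → ℝ) : Prop where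
  le_cost : ∀ i, ∀ r ∈ X.release i, w i r ≤ X.cost i r
  le_CL : ∀ i, ∀ r ∈ X.release i, ¬ X.InHC C i t → w i r ≤ (C.task i).CL
  add_DL_le : ∀ i, ∀ r ∈ X.release i, 0 < w i r → r + (C.task i).DL ≤ t
  add_D_le : ∀ i, ∀ r ∈ X.release i, 0 < w i r → X.InHC C i r → r + (C.task i).D ≤ t
  add_D_le_of_CL_lt : ∀ i, ∀ r ∈ X.release i, (C.task i).CL < w i r → r + (C.task i).D ≤ t
  le_sub : ∀ i, (C.task i).level = Level.LC → ∀ r ∈ X.release i, 0 < w i r → w i r ≤ u - r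

/-- Demand of an HC task: it is bounded by its demand bound without a switch, or the task has
switched by `t` and it is bounded by its demand bound for a switch at `u`. -/
lemma IsDemand.sum_le_of_HC {a u t : ℝ} {w : ι → ℝ → ℝ} (hw : X.IsDemand C a u t w)
    (hX : X.IsRun C I) (hau : a ≤ u) (hut : u ≤ t)
    (hu1 : u = a ∨ ¬ X.IMS C u) (hmin : ∀ x < t, X.MeetsDeadlinesAt C x) {i : ι}
    (hl : (C.task i).level = Level.HC)
    {J : Finset ℝ} (hJ : ∀ r ∈ J, r ∈ X.release i ∧ a ≤ r) :
    ∑ r ∈ J, w i r ≤ (C.task i).dbf (t - a) (t - a) ∨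
      X.InHC C i t ∧ ∑ r ∈ J, w i r ≤ (C.task i).dbf (t - a) (u - a) := by
  have hDL := (C.task i).DL_pos
  have hCL := (C.task i).CL_pos
  have hsep : ∀ r ∈ J, ∀ r' ∈ J, r < r' → r + (C.task i).T ≤ r' := fun r hr r' hr' =>
    hX.separation i r (hJ r hr).1 r' (hJ r' hr').1
  by_cases hex : ∃ r ∈ J, (C.task i).CL < w i r
  · right
    have hHC : X.InHC C i t := by
      obtain ⟨r, hr, h⟩ := hex
      by_contra hcon
      exact absurd (hw.le_CL i r (hJ r hr).1 hcon) (not_le.2 h)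
    have hsw : ∀ r ∈ J, (C.task i).CL < w i r → r + (C.task i).DL < t →
        X.InHC C i (r + (C.task i).DL) := fun r hr h hlt =>
      InHC_of_CL_lt_cost hl (hJ r hr).1 (h.trans_le (hw.le_cost i r (hJ r hr).1)) (hmin _ hlt)
    refine ⟨hHC, sum_le_dbf_of_switch (C.task i) hl hau hsep (fun r hr => (hJ r hr).2)
      (fun r hr => (hw.le_cost i r (hJ r hr).1).trans (hX.cost_le i r (hJ r hr).1)) ?_ ?_ hex⟩
    · intro r hr h
      refine ⟨hw.add_D_le_of_CL_lt i r (hJ r hr).1 h, ?_⟩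
      -- otherwise the task has switched by `r + DL ≤ u`
      by_contra! hcon
      have hIMS : X.IMS C u := by
        rcases (hcon.trans hut).lt_or_eq with hlt | heq
        · exact ⟨i, (hsw r hr h hlt).mono hcon⟩
        · exact ⟨i, hHC.mono (heq ▸ hcon)⟩
      rcases hu1 with h1 | h1
      · linarith [(hJ r hr).2]
      · exact h1 hIMS
    -- the task has switched by `r + DL ≤ r + T ≤ r'`, so the deadline of job `r'` is `r' + D`
    · intro r hr h r' hr' hlt hpos
      have h1 := hsep r hr r' hr' hlt
      have h2 := hw.add_DL_le i r' (hJ r' hr').1 hpos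
      have h3 : (C.task i).DL ≤ (C.task i).T := (C.task i).DL_le_D.trans (C.task i).D_le_T
      exact hw.add_D_le i r' (hJ r' hr').1 hpos
        ((hsw r hr h (by linarith)).mono (by linarith))
  · left
    push Not at hex
    exact sum_le_dbf_self (C.task i) hl (hau.trans hut) hsep (fun r hr => (hJ r hr).2)
      (fun r hr => hw.add_DL_le i r (hJ r hr).1) hex

/-- Demand of the component before its external mode switch. The tasks for which the demand bound
with a switch at `u` is used have switched by `t`, so there are at most `TL` of them. -/
lemma IsDemand.sum_le [Fintype ι] {a u t : ℝ} {w : ι → ℝ → ℝ} (hw : X.IsDemand C a u t w)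
    (hX : X.IsRun C I) (hau : a ≤ u) (hut : u ≤ t)
    (hu1 : u = a ∨ ¬ X.IMS C u) (hmin : ∀ x < t, X.MeetsDeadlinesAt C x) (hE : ¬ X.EMS C t)
    {J : ι → Finset ℝ} (hJ : ∀ i, ∀ r ∈ J i, r ∈ X.release i ∧ a ≤ r) :
    ∑ i, ∑ r ∈ J i, w i r ≤ C.dbf (t - a) (t - a) (u - a) := by
  classical
  have hlc : ∑ i ∈ C.lcTasks, ∑ r ∈ J i, w i r
      ≤ ∑ i ∈ C.lcTasks, (C.task i).dbf (t - a) (u - a) := by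
    refine Finset.sum_le_sum fun i hi => ?_
    have hl := Component.level_of_mem_lcTasks hi
    rw [Component.dbf_of_mem_lcTasks hi]
    exact sum_le_dbfA (C.task i) hau
      (fun r hr r' hr' => hX.separation i r (hJ i r hr).1 r' (hJ i r' hr').1)
      (fun r hr => (hJ i r hr).2) (fun r hr => hw.add_DL_le i r (hJ i r hr).1)
      (fun r hr => (hw.le_cost i r (hJ i r hr).1).trans (hX.cost_le_CL (hJ i r hr).1 hl))
      (fun r hr => hw.le_sub i hl r (hJ i r hr).1)
  set G := C.hcTasks.filter (fun i => X.InHC C i t) with hG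
  have hGk : G.card ≤ C.TL := by
    have h1 : {i | X.InHC C i t} = (G : Set ι) := by
      ext i
      simp only [Set.mem_ofPred_eq, hG, Finset.coe_filter, Component.hcTasks, Finset.mem_filter,
        Finset.mem_univ, true_and]
      exact ⟨fun h => ⟨h.1, h⟩, fun h => h.2⟩
    unfold EMS at hE
    rw [h1, Set.ncard_coe_finset] at hE
    exact not_lt.1 hE
  have hhc : ∑ i ∈ C.hcTasks, ∑ r ∈ J i, w i r
      ≤ ∑ i ∈ C.hcTasks, (C.task i).dbf (t - a) (t - a)
        + topSum C.hcTasks C.TL (C.delta (t - a) (t - a) (u - a)) := by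
    have h1 := sum_le_topSum (s := C.hcTasks) (f := C.delta (t - a) (t - a) (u - a))
      (Finset.filter_subset _ _ : G ⊆ C.hcTasks) hGk
    refine le_trans ?_ (add_le_add_right h1 _)
    rw [Finset.sum_filter, ← Finset.sum_add_distrib]
    refine Finset.sum_le_sum fun i hi => ?_
    have h0 : 0 ≤ C.delta (t - a) (t - a) (u - a) i := le_max_left _ _
    have h2 : (C.task i).dbf (t - a) (u - a) - (C.task i).dbf (t - a) (t - a)
      ≤ C.delta (t - a) (t - a) (u - a) i := le_max_right _ _
    rcases hw.sum_le_of_HC hX hau hut hu1 hmin (Component.level_of_mem_hcTasks hi) (hJ i) with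
      h | ⟨h, h'⟩
    · split_ifs <;> linarith
    · rw [if_pos h]
      linarith
  have hsplit : ∑ i, ∑ r ∈ J i, w i r
      = ∑ i ∈ C.hcTasks, ∑ r ∈ J i, w i r + ∑ i ∈ C.lcTasks, ∑ r ∈ J i, w i r := by
    have hlcF : C.lcTasks = Finset.univ.filter (fun i => ¬ (C.task i).level = Level.HC) := by
      ext i
      simp only [Component.lcTasks, Finset.mem_filter, Finset.mem_univ, true_and]
      cases (C.task i).level <;> simp
    rw [hlcF]
    exact (Finset.sum_filter_add_sum_filter_not _ _ _).symm
  unfold Component.dbf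
  linarith

/-- The part of the execution of urgent jobs that counts as demand: all of it for HC tasks, and the
part until `u` for LC tasks. -/
def countedRun (X : Trace ι) (C : Component ι) (a u t : ℝ) (i : ι) (r : ℝ) : Set ℝ :=
  {x ∈ X.urgentRun C a t i r | (C.task i).level = Level.LC → x ≤ u}

open Classical in
/-- The demand of a job: its execution while urgent, increased by `g` for the job `(i₀, r₀)`. -/
noncomputable def demand (X : Trace ι) (C : Component ι) (a u t : ℝ) (i₀ : ι) (r₀ g : ℝ)
    (i : ι) (r : ℝ) : ℝ :=
  volume.real (X.countedRun C a u t i r) + if i = i₀ ∧ r = r₀ then g else 0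

lemma measureReal_countedRun_le (a u t : ℝ) (i : ι) (r : ℝ) :
    volume.real (X.countedRun C a u t i r) ≤ volume.real (X.urgentRun C a t i r) :=
  measureReal_mono (Set.sep_subset _ _) (urgentRun_ne_top i r)

lemma measureReal_countedRun_le_exec (a u t : ℝ) (i : ι) (r : ℝ) :
    volume.real (X.countedRun C a u t i r) ≤ X.exec i r t :=
  measureReal_mono (fun _ hx => ⟨hx.1.1, hx.1.2.2.2.1.2.1, hx.1.2.2.1.le⟩)
    (measure_ne_top_of_subset Set.inter_subset_right (by simp))

/-- If job `(i₀, r₀)` misses its deadline `t`, then the demand of the jobs exceeds their execution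
by some `g > 0`. -/
lemma IsRun.exists_isDemand (hX : X.IsRun C I) {a t : ℝ} {i₀ : ι} {r₀ : ℝ}
    (hp : X.Pending C i₀ r₀ t) (hd : X.deadline C i₀ r₀ t = t) :
    ∃ g > 0, ∀ u, (u = t ∨ X.IMS C t) → X.IsDemand C a u t (X.demand C a u t i₀ r₀ g) := by
  classical
  have hr₀ := hp.1
  -- the cost that the missing job may reach without switching its task
  obtain ⟨c, hc, hcost, hCL⟩ : ∃ c, X.exec i₀ r₀ t < c ∧ c ≤ X.cost i₀ r₀ ∧
      (¬ X.InHC C i₀ t → c ≤ (C.task i₀).CL) := by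
    by_cases h : X.InHC C i₀ t
    · exact ⟨_, hp.2.2.1, le_rfl, fun h' => absurd h h'⟩
    · exact ⟨min (X.cost i₀ r₀) (C.task i₀).CL,
        lt_min hp.2.2.1 (hX.exec_lt_CL hr₀ hp.2.1 hp.2.2.1 h), min_le_left _ _,
        fun _ => min_le_right _ _⟩
  refine ⟨c - X.exec i₀ r₀ t, sub_pos.2 hc, fun u hu => ?_⟩
  have hmiss : X.demand C a u t i₀ r₀ (c - X.exec i₀ r₀ t) i₀ r₀ ≤ c := by
    unfold demand
    rw [if_pos ⟨rfl, rfl⟩]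
    linarith [measureReal_countedRun_le_exec (X := X) (C := C) a u t i₀ r₀]
  have hother : ∀ {i r}, ¬ (i = i₀ ∧ r = r₀) →
      X.demand C a u t i₀ r₀ (c - X.exec i₀ r₀ t) i r = volume.real (X.countedRun C a u t i r) := by
    intro i r h
    unfold demand
    rw [if_neg h, add_zero]
  have hne : ∀ {i r}, 0 < volume.real (X.countedRun C a u t i r) →
      (X.countedRun C a u t i r).Nonempty := by
    intro i r h
    rw [Set.nonempty_iff_ne_empty]
    intro h'
    simp [h'] at h
  constructor
  · intro i r hr
    by_cases h : i = i₀ ∧ r = r₀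
    · obtain ⟨rfl, rfl⟩ := h
      exact hmiss.trans hcost
    · rw [hother h]
      exact (measureReal_countedRun_le a u t i r).trans (measureReal_urgentRun_le_cost hX hr)
  · intro i r hr hn
    by_cases h : i = i₀ ∧ r = r₀
    · obtain ⟨rfl, rfl⟩ := h
      exact hmiss.trans (hCL hn)
    · rw [hother h]
      exact (measureReal_countedRun_le a u t i r).trans
        (measureReal_urgentRun_le_CL hX fun x hx h => hn (h.mono hx.2.2.1.le))
  · intro i r hr hpos
    by_cases h : i = i₀ ∧ r = r₀
    · obtain ⟨rfl, rfl⟩ := h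
      exact (add_DL_le_deadline i r t).trans hd.le
    · rw [hother h] at hpos
      obtain ⟨x, hx⟩ := hne hpos
      exact (add_DL_le_deadline i r x).trans hx.1.2.2.2.2
  · intro i r hr hpos hHC
    by_cases h : i = i₀ ∧ r = r₀
    · obtain ⟨rfl, rfl⟩ := h
      rw [← deadline_of_InHC (hHC.mono hp.2.1)]
      exact hd.le
    · rw [hother h] at hpos
      obtain ⟨x, hx⟩ := hne hpos
      rw [← deadline_of_InHC (hHC.mono hx.1.2.2.2.1.2.1)]
      exact hx.1.2.2.2.2
  · intro i r hr hlt
    by_cases h : i = i₀ ∧ r = r₀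
    · obtain ⟨rfl, rfl⟩ := h
      by_cases hHC : X.InHC C i t
      · rw [← deadline_of_InHC hHC]
        exact hd.le
      · exact absurd (hmiss.trans (hCL hHC)) (not_le.2 hlt)
    · rw [hother h] at hlt
      by_contra hcon
      refine absurd ((measureReal_countedRun_le a u t i r).trans
        (measureReal_urgentRun_le_CL hX fun x hx hHC => hcon ?_)) (not_le.2 hlt)
      rw [← deadline_of_InHC hHC]
      exact hx.2.2.2.2
  · intro i hl r hr hpos
    by_cases h : i = i₀ ∧ r = r₀
    · obtain ⟨rfl, rfl⟩ := h
      have hHC : ¬ X.InHC C i t := fun h => by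
        have := h.1
        rw [hl] at this
        cases this
      -- an LC task that is not dropped at `t` is accounted for until `t`, and `CL ≤ DL = t - r`
      have hut : u = t := hu.resolve_right fun h => hp.2.2.2 ⟨hl, Or.inl h⟩
      rw [deadline_of_not_InHC hHC] at hd
      linarith [hmiss.trans (hCL hHC), (C.task i).CL_le_DL]
    · rw [hother h] at hpos ⊢
      obtain ⟨x, hx⟩ := hne hpos
      have hru : r ≤ u := hx.1.2.2.2.1.2.1.trans (hx.2 hl)
      rw [← Real.volume_real_Icc_of_le hru]
      exact measureReal_mono (fun y hy => ⟨hy.1.2.2.2.1.2.1, hy.2 hl⟩) (by simp)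

/-- In a busy period, supply is only used by urgent jobs. -/
lemma IsRun.supply_le [Fintype ι] (hX : X.IsRun C I) {a u t ε : ℝ} (hε : 0 ≤ ε)
    (hE : ¬ X.EMS C t)
    (hbusy : ∀ x, a < x → x < t → X.Urgent C t x)
    (hstart : ∀ i r x, a < x → x < t → X.Pending C i r x → X.deadline C i r x ≤ t → a ≤ r)
    (hu : ∀ x, u + ε < x → x < t → X.IMS C x)
    {J : ι → Finset ℝ} (hJ : ∀ i, ∀ r ∈ X.release i, a ≤ r → r ≤ t → r ∈ J i) :
    volume.real (X.supply ∩ Set.Ico a t)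
      ≤ ∑ i, ∑ r ∈ J i, volume.real (X.countedRun C a u t i r) + ε := by
  classical
  set U : Set ℝ := (⋃ i ∈ (Finset.univ : Finset ι), ⋃ r ∈ J i, X.countedRun C a u t i r)
    ∪ Set.Icc u (u + ε) with hU
  have hfin : ∀ i r, volume (X.countedRun C a u t i r) ≠ ⊤ := fun i r =>
    measure_ne_top_of_subset (Set.sep_subset _ _) (urgentRun_ne_top i r)
  have hsub : (X.supply ∩ Set.Ico a t : Set ℝ) ≤ᵐ[volume] U := by
    have hne : ∀ᵐ x : ℝ, x ≠ a := by simp [ae_iff]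
    filter_upwards [hX.edf, hX.work_conserving, hne] with x hedf hwc hxa hx
    obtain ⟨hxs, hax, hxt⟩ := hx
    have hax : a < x := lt_of_le_of_ne hax (Ne.symm hxa)
    have hEx : ¬ X.EMS C x := fun h => hE (h.mono hxt.le)
    obtain ⟨j, r', hp', hd'⟩ := hbusy x hax hxt
    obtain ⟨i, r, hrun⟩ := hwc hEx hxs ⟨j, r', hp'⟩
    obtain ⟨-, hp, hfirst⟩ := hedf hEx i r hrun
    have hd := (hfirst j r' hp').trans hd'
    have hr : r ∈ J i := hJ i r hp.1 (hstart i r x hax hxt hp hd) (hp.2.1.trans hxt.le)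
    have hmem : x ∈ X.urgentRun C a t i r := ⟨hrun, hax, hxt, hp, hd⟩
    by_cases hc : (C.task i).level = Level.LC → x ≤ u
    · exact Or.inl (Set.mem_iUnion₂.2 ⟨i, Finset.mem_univ i, Set.mem_iUnion₂.2 ⟨r, hr, hmem, hc⟩⟩)
    -- an LC job executing after `u` is not dropped yet, so it executes by `u + ε`
    · push Not at hc
      refine Or.inr ⟨hc.2.le, ?_⟩
      by_contra! hcon
      exact hp.2.2.2 ⟨hc.1, Or.inl (hu x hcon hxt)⟩
  have hUfin : volume U ≠ ⊤ := by
    refine measure_union_ne_top (ne_top_of_le_ne_top ?_ (measure_biUnion_finset_le _ _)) (by simp)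
    refine ENNReal.sum_ne_top.2 fun i _ => ne_top_of_le_ne_top ?_ (measure_biUnion_finset_le _ _)
    exact ENNReal.sum_ne_top.2 fun r _ => hfin i r
  have h1 : volume.real (X.supply ∩ Set.Ico a t) ≤ volume.real U :=
    ENNReal.toReal_mono hUfin (measure_mono_ae hsub)
  have h2 := measureReal_union_le (μ := volume)
    (⋃ i ∈ (Finset.univ : Finset ι), ⋃ r ∈ J i, X.countedRun C a u t i r) (Set.Icc u (u + ε))
  rw [Real.volume_real_Icc_of_le (by linarith), add_sub_cancel_left] at h2
  have h3 := measureReal_biUnion_finset_le (μ := volume) (Finset.univ : Finset ι)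
    (fun i => ⋃ r ∈ J i, X.countedRun C a u t i r)
  have h4 := Finset.sum_le_sum fun i (_ : i ∈ (Finset.univ : Finset ι)) =>
    measureReal_biUnion_finset_le (μ := volume) (J i) (fun r => X.countedRun C a u t i r)
  linarith

/-- A first deadline miss contradicts the demand bound. -/
lemma IsRun.meetsDeadlinesAt_of_lt [Fintype ι] (hX : X.IsRun C I)
    (hdbf : ∀ t tI : ℝ, 0 ≤ tI → tI ≤ t → C.dbf t t tI ≤ I.sbfLC t) {t : ℝ} (hE : ¬ X.EMS C t)
    (hmin : ∀ x < t, X.MeetsDeadlinesAt C x) : X.MeetsDeadlinesAt C t := by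
  classical
  intro i₀ r₀ hr₀ hdrop hd
  by_contra! hmiss
  have hrt : r₀ + (C.task i₀).DL ≤ t := (add_DL_le_deadline i₀ r₀ t).trans hd.le
  have hDL := (C.task i₀).DL_pos
  have hp : X.Pending C i₀ r₀ t := ⟨hr₀, by linarith, hmiss, hdrop⟩
  obtain ⟨a, har, hbusy, hstart⟩ := hX.exists_busy_start hp hd.le
  have hat : a ≤ t := by linarith
  obtain ⟨g, hg, hdem⟩ := hX.exists_isDemand (a := a) hp hd
  obtain ⟨u, hau, hut, hu1, hu2, hu3⟩ := exists_before_IMS X C hat (half_pos hg)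
  set J : ι → Finset ℝ := fun i => (hX.finite_release i t).toFinset.filter (fun r => a ≤ r)
    with hJdef
  have hJ : ∀ i r, r ∈ J i ↔ (r ∈ X.release i ∧ r ≤ t) ∧ a ≤ r := by
    intro i r
    simp [hJdef]
  have h1 := (hdem u hu2).sum_le hX hau hut hu1 hmin hE (J := J)
    (fun i r hr => ⟨((hJ i r).1 hr).1.1, ((hJ i r).1 hr).2⟩)
  have h2 := hX.supply_le (half_pos hg).le hE hbusy hstart hu3 (J := J)
    (fun i r hr har hrt => (hJ i r).2 ⟨⟨hr, hrt⟩, har⟩)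
  obtain ⟨φ, hφ⟩ := hX.supply_periodic
  have h3 := sbfLC_le_supply I hφ hat
  have h4 := hdbf (t - a) (u - a) (by linarith) (by linarith)
  have h5 : ∑ i, ∑ r ∈ J i, X.demand C a u t i₀ r₀ g i r
      = ∑ i, ∑ r ∈ J i, volume.real (X.countedRun C a u t i r) + g := by
    unfold demand
    simp_rw [Finset.sum_add_distrib]
    congr 1
    rw [Finset.sum_eq_single i₀ (fun i _ hi => Finset.sum_eq_zero fun r _ => by simp [hi])
      (by simp), Finset.sum_eq_single r₀ (fun r _ hr => by simp [hr])
      (fun h => absurd ((hJ i₀ r₀).2 ⟨⟨hr₀, by linarith⟩, har⟩) h)]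
    simp
  linarith

/-- If every deadline is met whose predecessors are met, all deadlines are met: every time is
preceded by finitely many deadlines only. -/
lemma IsRun.meetsDeadlinesAt [Finite ι] (hX : X.IsRun C I)
    (hstep : ∀ t, ¬ X.EMS C t → (∀ x < t, X.MeetsDeadlinesAt C x) → X.MeetsDeadlinesAt C t)
    {t : ℝ} (hE : ¬ X.EMS C t) : X.MeetsDeadlinesAt C t := by
  by_contra ht
  set S := {x | x ≤ t ∧ ¬ X.MeetsDeadlinesAt C x} with hS
  have hfin : S.Finite := by
    refine (Set.finite_iUnion fun i => ((hX.finite_release i t).image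
      (fun r => r + (C.task i).D)).union ((hX.finite_release i t).image
      (fun r => r + (C.task i).DL))).subset ?_
    rintro x ⟨hxt, hx⟩
    unfold MeetsDeadlinesAt at hx
    push Not at hx
    obtain ⟨i, r, hr, -, hd, -⟩ := hx
    have hrt : r ≤ t := by
      linarith [add_DL_le_deadline (X := X) (C := C) i r x, (C.task i).DL_pos]
    refine Set.mem_iUnion.2 ⟨i, ?_⟩
    unfold deadline at hd
    split_ifs at hd
    · exact Or.inl ⟨r, ⟨hr, hrt⟩, hd⟩
    · exact Or.inr ⟨r, ⟨hr, hrt⟩, hd⟩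
  obtain ⟨x, hx, hmin⟩ := Set.exists_min_image S id hfin ⟨t, le_rfl, ht⟩
  refine hx.2 (hstep x (fun h => hE (h.mono hx.1)) fun y hy => ?_)
  by_contra hcon
  exact absurd (hmin y ⟨hy.le.trans hx.1, hcon⟩) (not_le.2 hy)

end Trace

end MixedCrit

open MixedCrit in
theorem theorem2 {ι : Type*} [Fintype ι] (C : Component ι) (I : MCPR) :
    ((∀ t : ℝ, 0 ≤ t → (t : EReal) ≤ tMAX C I → ∀ tI : ℝ, 0 ≤ tI → tI ≤ t →
        C.dbf t t tI ≤ I.sbfLC t) →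
      SchedulableInLCMode C I) ∧
    (0 < slack C I → ∀ M : ℝ, I.T ≤ M → (∀ i, (C.task i).T ≤ M ∧ (C.task i).CH ≤ M) →
      tMAX C I ≤ ((2 * (Fintype.card ι + 1) * M / slack C I : ℝ) : EReal)) := by
  refine ⟨fun h X hX t hE => ?_, fun hs M hI hM => tMAX_le C I hs hI hM⟩
  refine hX.meetsDeadlinesAt (fun t hE hmin => hX.meetsDeadlinesAt_of_lt ?_ hE hmin) hE
  intro t tI h0 ht
  rcases le_or_gt (t : EReal) (tMAX C I) with hle | hlt
  · exact h t (h0.trans ht) hle tI h0 ht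
  · exact dbf_le_sbfLC_of_tMAX_lt C I h0 ht hlt
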